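/- Let $\mathbf F_q$ be a finite field with $q$ elements. For a set $S$ of $\mathbf F_q$-isomorphism classes $[E]$ of elliptic curves over $\mathbf F_q$, let $\#'S=\sum_{[E]\in S}1/\#\mathrm{Aut}_{\mathbf F_q}(E)$ denote its weighted cardinality. For a positive integer $N$ let $$V(\mathbf F_q;N)=\{E/\mathbf F_q : N\mid \#E(\mathbf F_q)\}/{\cong_{\mathbf F_q}},\qquad v(N)=\#'V(\mathbf F_q;N),$$ and for positive integers $m\mid n$ let $$W(\mathbf F_q;m,n)=\{E/\mathbf F_q : E[n](\mathbf F_q)\cong(\mathbf Z/m\mathbf Z)\times(\mathbf Z/n\mathbf Z)\}/{\cong_{\mathbf F_q}},\qquad w(m,n)=\#'W(\mathbf F_q;m,n).$$ Let $t$ and $u$ be the multiplicative arithmetic functions given on prime powers by $t(\ell^a)=\ell^{\lfloor a/2\rfloor}$ and $u(\ell^a)=\ell^{\lceil a/2\rceil}$. Then for every positive integer $N$, $$V(\mathbf F_q;N)=\coprod_{d\mid\gcd(u(N),\,q-1)}W\!\left(\mathbf F_q;d,\frac{N}{\gcd(d,t(N))}\right)$$ (that is, $V(\mathbf F_q;N)$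 is the union of these sets, and they are pairwise disjoint for distinct positive divisors $d$), and $$v(N)=\sum_{d\mid\gcd(u(N),\,q-1)}w\!\left(d,\frac{N}{\gcd(d,t(N))}\right).$$ -/

import Mathlib

namespace EllipticCount

open WeierstrassCurve

/-- Elliptic curves over a field `F`, given by nonsingular Weierstrass equations. -/
abbrev EllCurve (F : Type*) [Field F] : Type _ := {E : WeierstrassCurve F // E.IsElliptic}

/-- `F`-isomorphism of elliptic curves: an admissible change of variables with coefficients
in `F` carries one Weierstrass equation to the other. -/
def isoSetoid (F : Type*) [Field F] : Setoid (EllCurve F) where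
  r E E' := ∃ C : VariableChange F, C • E.1 = E'.1
  iseqv :=
    { refl := fun E => ⟨1, one_smul _ E.1⟩
      symm := fun ⟨C, h⟩ => ⟨C⁻¹, by rw [← h, inv_smul_smul]⟩
      trans := fun ⟨C, h⟩ ⟨C', h'⟩ => ⟨C' * C, by rw [mul_smul, h, h']⟩ }

/-- The set of `F`-isomorphism classes of elliptic curves over `F`. -/
def IsoClass (F : Type*) [Field F] : Type _ := Quotient (isoSetoid F)

/-- The class `[E]` of an elliptic curve `E`. -/
def isoClass {F : Type*} [Field F] (E : EllCurve F) : IsoClass F := Quotient.mk (isoSetoid F) E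

/-- Over a finite field there are only finitely many isomorphism classes of elliptic curves. -/
instance (F : Type*) [Field F] [Finite F] : Finite (IsoClass F) := by
  have h : Finite (WeierstrassCurve F) :=
    Finite.of_injective
      (fun E : WeierstrassCurve F => (E.a₁, E.a₂, E.a₃, E.a₄, E.a₆)) (by
        intro E E' h
        simp only [Prod.mk.injEq] at h
        obtain ⟨h₁, h₂, h₃, h₄, h₆⟩ := h
        exact WeierstrassCurve.ext h₁ h₂ h₃ h₄ h₆)
  exact Quotient.finite _

/-- `Aut_F(E)`: the changes of variables over `F` that preserve the equation of `E`. -/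
def autGroup {F : Type*} [Field F] (E : EllCurve F) : Subgroup (VariableChange F) :=
  MulAction.stabilizer (VariableChange F) E.1

/-- The number `#Aut_F(E)`, which depends only on the class `[E]`. -/
noncomputable def IsoClass.autCard {F : Type*} [Field F] : IsoClass F → ℕ :=
  Quotient.lift (s := isoSetoid F) (fun E => Nat.card (autGroup E)) (by
    rintro E E' ⟨C, h⟩
    exact Nat.card_congr (MulAction.stabilizerEquivStabilizer h.symm).toEquiv)

/-- The weighted cardinality `#'S = ∑_{[E] ∈ S} 1 / #Aut_F(E)` of a set of isomorphism classes of
elliptic curves (used only over finite fields, where the sum is finite). -/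
noncomputable def weightedCard {F : Type*} [Field F] (S : Set (IsoClass F)) : ℚ :=
  ∑ᶠ c ∈ S, (1 : ℚ) / c.autCard

/-- `V(F; N)`: classes of the elliptic curves `E` over `F` such that `N` divides `#E(F)`. -/
def setV (F : Type*) [Field F] (N : ℕ) : Set (IsoClass F) :=
  {c | ∃ E : EllCurve F, isoClass E = c ∧ N ∣ Nat.card E.1.toAffine.Point}

/-- `W(F; m, n)`: classes of the elliptic curves `E` over `F` such that
`E[n](F)` is isomorphic to `ℤ/m × ℤ/n`. -/
def setW (F : Type*) [Field F] [DecidableEq F] (m n : ℕ) : Set (IsoClass F) :=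
  {c | ∃ E : EllCurve F, isoClass E = c ∧
    Nonempty (AddSubgroup.torsionBy E.1.toAffine.Point (n : ℤ) ≃+ ZMod m × ZMod n)}

/-- `v(N)`, the weighted cardinality of `V(F; N)`. -/
noncomputable def vCard (F : Type*) [Field F] (N : ℕ) : ℚ := weightedCard (setV F N)

/-- `w(m, n)`, the weighted cardinality of `W(F; m, n)`. -/
noncomputable def wCard (F : Type*) [Field F] [DecidableEq F] (m n : ℕ) : ℚ :=
  weightedCard (setW F m n)

/-- The multiplicative function with `t(ℓ ^ a) = ℓ ^ ⌊a / 2⌋` on prime powers. -/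
noncomputable def tFun (N : ℕ) : ℕ := N.factorization.prod fun ℓ a => ℓ ^ ⌊(a : ℚ) / 2⌋₊

/-- The multiplicative function with `u(ℓ ^ a) = ℓ ^ ⌈a / 2⌉` on prime powers. -/
noncomputable def uFun (N : ℕ) : ℕ := N.factorization.prod fun ℓ a => ℓ ^ ⌈(a : ℚ) / 2⌉₊

end EllipticCount

/-! Everything rests on one structural fact (`exists_point_addEquiv`): E(F_q) ≅ ℤ/a × ℤ/b with a ∣ b
and a ∣ q - 1. If N ∣ ab, put d = gcd(a, u(N)) and n = N / gcd(d, t(N)). Comparing exponents prime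
by prime gives gcd(a, n) = d and n ∣ b (`gcd_div_gcd_tFun`), so E[n](F_q) ≅ ℤ/d × ℤ/n. Conversely,
such a subgroup has order dn, a multiple of N. The sets are disjoint because #E[u(N)](F_q) = d·u(N)
recovers d.

The structural fact is proved without the Weil pairing, inside E(K) with K = F(E) the function
field. Points of E(K) stand for rational maps E → E: the generic point g is the identity, n • g is
multiplication by n, and the q-power image π of g is Frobenius. If P is odd (compatible with
negation), x(P) lies in F(x), and its degree as a rational function, the height of P, plays the role
of the degree of the map. The formulas for x(P + Q) and x(P - Q) yield a parallelogram law
(`HasHeight.add_add_sub`), so the height of P + j • g is a monic quadratic in j. If P is invariant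
under translation by a finite G ≤ E(F), then translations and negation give 2·#G automorphisms of K
fixing x(P), whence #G divides the height (`card_dvd_of_hasHeight`).

Applied to n • g, of height n², this gives #E[n](F) ∣ n², hence at most two cyclic factors. If
#E[m](F) = m², applying it to π + j • g with j ≡ -1 mod m gives m² ∣ q + jB + j², and two choices of
j force m ∣ q - 1. -/

set_option linter.unusedSectionVars false

/-! ### Finite abelian groups: torsion subgroups and two cyclic factors. -/

section AbelianGroups

theorem mem_torsionBy_natCast {A : Type*} [AddCommGroup A] {n : ℕ} {x : A} :
    x ∈ AddSubgroup.torsionBy A (n : ℤ) ↔ n • x = 0 := by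
  rw [AddSubgroup.torsionBy, Submodule.mem_toAddSubgroup, Submodule.mem_torsionBy_iff,
    natCast_zsmul]

/-- An isomorphism of abelian groups restricts to the torsion subgroups. -/
def AddEquiv.torsionByCongr {A B : Type*} [AddCommGroup A] [AddCommGroup B] (e : A ≃+ B) (n : ℕ) :
    AddSubgroup.torsionBy A (n : ℤ) ≃+ AddSubgroup.torsionBy B (n : ℤ) where
  toFun x := ⟨e x, mem_torsionBy_natCast.2 <| by
    rw [← map_nsmul, mem_torsionBy_natCast.1 x.2, map_zero]⟩
  invFun x := ⟨e.symm x, mem_torsionBy_natCast.2 <| by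
    rw [← map_nsmul, mem_torsionBy_natCast.1 x.2, map_zero]⟩
  left_inv x := by simp
  right_inv x := by simp
  map_add' x y := by ext; simp

/-- The torsion subgroup of a product is the product of the torsion subgroups. -/
def torsionByProdEquiv (A B : Type*) [AddCommGroup A] [AddCommGroup B] (n : ℕ) :
    AddSubgroup.torsionBy (A × B) (n : ℤ) ≃+
      AddSubgroup.torsionBy A (n : ℤ) × AddSubgroup.torsionBy B (n : ℤ) where
  toFun x := ⟨⟨x.1.1, mem_torsionBy_natCast.2 (congrArg Prod.fst (mem_torsionBy_natCast.1 x.2))⟩,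
    ⟨x.1.2, mem_torsionBy_natCast.2 (congrArg Prod.snd (mem_torsionBy_natCast.1 x.2))⟩⟩
  invFun x := ⟨⟨x.1.1, x.2.1⟩, mem_torsionBy_natCast.2 <| Prod.ext
    (mem_torsionBy_natCast.1 x.1.2) (mem_torsionBy_natCast.1 x.2.2)⟩
  left_inv _ := rfl
  right_inv _ := rfl
  map_add' _ _ := rfl

theorem card_torsionBy_zmod (a n : ℕ) [NeZero a] :
    Nat.card (AddSubgroup.torsionBy (ZMod a) (n : ℤ)) = a.gcd n := by
  rw [show AddSubgroup.torsionBy (ZMod a) (n : ℤ) = (nsmulAddMonoidHom (α := ZMod a) n).ker by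
    ext x; rw [mem_torsionBy_natCast, AddMonoidHom.mem_ker, nsmulAddMonoidHom_apply],
    IsAddCyclic.card_nsmulAddMonoidHom_ker, Nat.card_zmod]

/-- The `n`-torsion of `ZMod a` is cyclic of order `gcd a n`. -/
noncomputable def torsionByZModEquiv (a n : ℕ) [NeZero a] :
    AddSubgroup.torsionBy (ZMod a) (n : ℤ) ≃+ ZMod (a.gcd n) :=
  addEquivOfAddCyclicCardEq (by rw [card_torsionBy_zmod, Nat.card_zmod])

theorem card_torsionBy_of_equiv_zmod_prod {A : Type*} [AddCommGroup A] {a b : ℕ} [NeZero a]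
    [NeZero b] (e : A ≃+ ZMod a × ZMod b) (n : ℕ) :
    Nat.card (AddSubgroup.torsionBy A (n : ℤ)) = a.gcd n * b.gcd n := by
  rw [Nat.card_congr ((e.torsionByCongr n).trans (torsionByProdEquiv _ _ n)).toEquiv,
    Nat.card_prod, card_torsionBy_zmod, card_torsionBy_zmod]

/-- The `n`-torsion of a product of two cyclic groups. -/
noncomputable def torsionByEquivOfZModProd {A : Type*} [AddCommGroup A] {a b : ℕ} [NeZero a]
    [NeZero b] (e : A ≃+ ZMod a × ZMod b) (n : ℕ) :
    AddSubgroup.torsionBy A (n : ℤ) ≃+ ZMod (a.gcd n) × ZMod (b.gcd n) :=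
  ((e.torsionByCongr n).trans (torsionByProdEquiv _ _ n)).trans
    ((torsionByZModEquiv a n).prodCongr (torsionByZModEquiv b n))

/-- The `n`-torsion subgroup of the `k`-torsion subgroup, when `n ∣ k`. -/
theorem card_torsionBy_torsionBy {A : Type*} [AddCommGroup A] {n k : ℕ} (h : n ∣ k) :
    Nat.card (AddSubgroup.torsionBy (AddSubgroup.torsionBy A (k : ℤ)) (n : ℤ)) =
      Nat.card (AddSubgroup.torsionBy A (n : ℤ)) := by
  obtain ⟨c, rfl⟩ := h
  refine Nat.card_congr
    { toFun := fun x => ⟨x.1.1, mem_torsionBy_natCast.2 ?_⟩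
      invFun := fun x => ⟨⟨x.1, mem_torsionBy_natCast.2 ?_⟩, mem_torsionBy_natCast.2 ?_⟩
      left_inv := fun _ => rfl
      right_inv := fun _ => rfl }
  · exact congrArg Subtype.val (mem_torsionBy_natCast.1 x.2)
  · rw [mul_comm, mul_nsmul', mem_torsionBy_natCast.1 x.2, smul_zero]
  · exact Subtype.ext (mem_torsionBy_natCast.1 x.2)

theorem card_torsionBy_pi {ι : Type*} [Fintype ι] (A : ι → Type*) [∀ i, AddCommGroup (A i)]
    (n : ℕ) : Nat.card (AddSubgroup.torsionBy (∀ i, A i) (n : ℤ)) =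
      ∏ i, Nat.card (AddSubgroup.torsionBy (A i) (n : ℤ)) := by
  rw [← Nat.card_pi]
  exact Nat.card_congr
    { toFun := fun x i => ⟨x.1 i, mem_torsionBy_natCast.2 (congrFun (mem_torsionBy_natCast.1 x.2) i)⟩
      invFun := fun x => ⟨fun i => x i, mem_torsionBy_natCast.2 <| funext fun i =>
        mem_torsionBy_natCast.1 (x i).2⟩
      left_inv := fun _ => rfl
      right_inv := fun _ => rfl }

/-- `Equiv.piEquivPiSubtypeProd` as an additive equivalence. -/
def piSubtypeProdAddEquiv {ι : Type*} (p : ι → Prop) [DecidablePred p] (A : ι → Type*)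
    [∀ i, AddCommGroup (A i)] :
    (∀ i, A i) ≃+ (∀ i : {i // p i}, A i) × (∀ i : {i // ¬ p i}, A i) :=
  { Equiv.piEquivPiSubtypeProd p A with map_add' := fun _ _ => rfl }

/-- The hypothesis leaves at most two cyclic p-power factors for each p. The larger ones are
assembled into ℤ/b by the Chinese remainder theorem, the remaining ones into ℤ/a. -/
theorem exists_addEquiv_zmod_prod {A : Type*} [AddCommGroup A] [Finite A]
    (h : ∀ p : ℕ, p.Prime → Nat.card (AddSubgroup.torsionBy A (p : ℤ)) ∣ p ^ 2) :
    ∃ a b : ℕ, 0 < a ∧ 0 < b ∧ a ∣ b ∧ Nonempty (A ≃+ ZMod a × ZMod b) := by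
  classical
  obtain ⟨ι₀, _, p₀, hp₀, e₀, ⟨f₀⟩⟩ := AddCommGroup.equiv_directSum_zmod_of_finite A
  obtain ⟨ι, _, p, e, hp, he, ⟨f⟩⟩ : ∃ (ι : Type) (_ : Fintype ι) (p e : ι → ℕ)
      (_ : ∀ i, (p i).Prime) (_ : ∀ i, e i ≠ 0), Nonempty (A ≃+ ∀ i, ZMod (p i ^ e i)) :=
by
    -- Factors with exponent 0 are trivial; once they are discarded, every factor at p contributes
    -- exactly p to the p-torsion.
    have : Unique (∀ i : {i // ¬ e₀ i ≠ 0}, ZMod (p₀ i ^ e₀ i)) :=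
      { default := 0
        uniq := fun x => funext fun i => by
          have : Subsingleton (ZMod (p₀ i ^ e₀ i)) := by
            rw [not_not.1 i.2, pow_zero]; infer_instance
          exact Subsingleton.elim _ _ }
    exact ⟨{i : ι₀ // e₀ i ≠ 0}, inferInstance, fun i => p₀ i, fun i => e₀ i, fun i => hp₀ i,
      fun i => i.2, ⟨((f₀.trans (DirectSum.addEquivProd _)).trans
        (piSubtypeProdAddEquiv (fun i => e₀ i ≠ 0) _)).trans AddEquiv.prodUnique⟩⟩
  have hcop : ∀ i j, p i ≠ p j → Nat.Coprime (p i ^ e i) (p j ^ e j) := fun i j hij =>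
    Nat.Coprime.pow _ _ ((Nat.coprime_primes (hp i) (hp j)).2 hij)
  have htwo : ∀ i j k, i ≠ j → i ≠ k → j ≠ k → p i = p j → p j = p k → False := by
    intro i j k hij hik hjk hpij hpjk
    have h1 := h (p i) (hp i)
    rw [Nat.card_congr (f.torsionByCongr (p i)).toEquiv, card_torsionBy_pi] at h1
    have h2 : ∏ x ∈ {i, j, k}, Nat.card (AddSubgroup.torsionBy (ZMod (p x ^ e x)) (p i : ℤ)) ∣
        p i ^ 2 := (Finset.prod_dvd_prod_of_subset _ _ _ (Finset.subset_univ _)).trans h1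
    have h3 : ∀ x, p x = p i →
        Nat.card (AddSubgroup.torsionBy (ZMod (p x ^ e x)) (p i : ℤ)) = p i := by
      intro x hx
      have : NeZero (p x ^ e x) := ⟨pow_ne_zero _ (hp x).ne_zero⟩
      rw [card_torsionBy_zmod, hx]
      exact Nat.gcd_eq_right (dvd_pow_self _ (he x))
    rw [Finset.prod_insert (by simp [hij, hik]), Finset.prod_insert (by simp [hjk]),
      Finset.prod_singleton, h3 i rfl, h3 j hpij.symm, h3 k (hpjk.symm.trans hpij.symm),
      ← pow_two, ← pow_succ', Nat.pow_dvd_pow_iff_le_right (hp i).one_lt] at h2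
    omega
  -- `s` holds exactly one index, of maximal exponent, for each prime that occurs.
  obtain ⟨s, hs⟩ : ∃ s : Set ι, ∀ i, ∃ j, p j = p i ∧ e i ≤ e j ∧ ∀ k, p k = p i → (k ∈ s ↔ k = j) := by
    have hmax : ∀ i, ∃ j, p j = p i ∧ ∀ k, p k = p i → e k ≤ e j := by
      intro i
      obtain ⟨j, hj, hj'⟩ := Finset.exists_max_image (Finset.univ.filter fun k => p k = p i) e
        ⟨i, by simp⟩
      exact ⟨j, by simpa using hj, fun k hk => hj' k (by simpa using hk)⟩
    choose M hM hM' using fun q : Set.range p => hmax q.2.choose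
    have hq : ∀ q : Set.range p, p q.2.choose = q := fun q => q.2.choose_spec
    refine ⟨Set.range M, fun i => ⟨M ⟨p i, i, rfl⟩, ?_, ?_, ?_⟩⟩
    · rw [hM, hq]
    · exact hM' _ _ (by rw [hq])
    · intro k hk
      constructor
      · rintro ⟨q, rfl⟩
        congr 1
        exact Subtype.ext (by rw [← hq q, ← hM q, hk])
      · rintro rfl
        exact ⟨_, rfl⟩
  choose J hJ hJe hJs using hs
  have hsc : ∀ i j, i ∈ s → j ∈ s → i ≠ j → p i ≠ p j := by
    intro i j hi hj hij hpij
    exact hij (((hJs i i rfl).1 hi).trans ((hJs i j hpij.symm).1 hj).symm)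
  have hsc' : ∀ i j, i ∉ s → j ∉ s → i ≠ j → p i ≠ p j := by
    intro i j hi hj hij hpij
    have hJi : J i ∈ s := (hJs i _ (hJ i)).2 rfl
    exact htwo i j (J i) hij (fun h => hi (h ▸ hJi)) (fun h => hj (h ▸ hJi)) hpij
      (hpij.symm.trans (hJ i).symm)
  refine ⟨∏ i : {i // i ∉ s}, p i ^ e i, ∏ i : {i // i ∈ s}, p i ^ e i,
    Finset.prod_pos fun i _ => pow_pos (hp i).pos _,
    Finset.prod_pos fun i _ => pow_pos (hp i).pos _, ?_, ?_⟩
  · refine Finset.prod_dvd_of_isRelPrime ?_ (fun i _ => ?_)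
    · intro i _ j _ hij
      exact Nat.coprime_iff_isRelPrime.1 (hcop _ _ (hsc' i j i.2 j.2 fun h => hij (Subtype.ext h)))
    · have hJi : J i ∈ s := (hJs i _ (hJ i)).2 rfl
      refine dvd_trans ?_ (Finset.dvd_prod_of_mem _ (Finset.mem_univ (⟨J i, hJi⟩ : {i // i ∈ s})))
      simp only [hJ]
      exact pow_dvd_pow _ (hJe i)
  · have e1 := ZMod.prodEquivPi (fun i : {i // i ∈ s} => p i ^ e i)
      (fun i j hij => hcop _ _ (hsc i j i.2 j.2 fun h => hij (Subtype.ext h)))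
    have e2 := ZMod.prodEquivPi (fun i : {i // i ∉ s} => p i ^ e i)
      (fun i j hij => hcop _ _ (hsc' i j i.2 j.2 fun h => hij (Subtype.ext h)))
    exact ⟨((f.trans (piSubtypeProdAddEquiv (· ∈ s) _)).trans (e1.symm.toAddEquiv.prodCongr e2.symm.toAddEquiv)).trans
      AddEquiv.prodComm⟩

end AbelianGroups

/-! ### Arithmetic of t and u. -/

section FloorAndCeilOfHalfExponents

open EllipticCount

theorem factorization_mapRange_prod_pow (N : ℕ) (g : ℕ → ℕ) (hg : g 0 = 0) (p : ℕ) :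
    (N.factorization.prod fun ℓ a => ℓ ^ g a).factorization p = g (N.factorization p) := by
  have h : (N.factorization.mapRange g hg).prod (fun ℓ a => ℓ ^ a) =
      N.factorization.prod fun ℓ a => ℓ ^ g a :=
    Finsupp.prod_mapRange_index fun _ => pow_zero _
  rw [← h, Nat.prod_pow_factorization_eq_self, Finsupp.mapRange_apply]
  intro q hq
  exact Nat.prime_of_mem_primeFactors (Finsupp.support_mapRange hq)

theorem prod_factorization_pow_pos (N : ℕ) (g : ℕ → ℕ) :
    0 < N.factorization.prod fun ℓ a => ℓ ^ g a :=
  Finset.prod_pos fun _ hp => pow_pos (Nat.prime_of_mem_primeFactors hp).pos _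

theorem tFun_pos (N : ℕ) : 0 < tFun N := prod_factorization_pow_pos N _

theorem uFun_pos (N : ℕ) : 0 < uFun N := prod_factorization_pow_pos N _

theorem factorization_tFun (N p : ℕ) : (tFun N).factorization p = N.factorization p / 2 := by
  rw [tFun, factorization_mapRange_prod_pow N (fun a => ⌊(a : ℚ) / 2⌋₊) (by simp)]
  exact_mod_cast Nat.floor_div_eq_div (K := ℚ) (N.factorization p) 2

theorem factorization_uFun (N p : ℕ) :
    (uFun N).factorization p = (N.factorization p + 1) / 2 := by
  rw [uFun, factorization_mapRange_prod_pow N (fun a => ⌈(a : ℚ) / 2⌉₊) (by simp)]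
  generalize N.factorization p = a
  refine le_antisymm (Nat.ceil_le.2 ?_) (Nat.le_of_lt_succ ?_)
  · rw [div_le_iff₀ two_pos]
    exact_mod_cast (by omega : a ≤ (a + 1) / 2 * 2)
  · have h : (a : ℚ) / 2 ≤ ⌈(a : ℚ) / 2⌉₊ := Nat.le_ceil _
    rw [div_le_iff₀ two_pos] at h
    have h' : a ≤ ⌈(a : ℚ) / 2⌉₊ * 2 := by exact_mod_cast h
    omega

theorem tFun_mul_uFun {N : ℕ} (hN : 0 < N) : tFun N * uFun N = N := by
  refine Nat.eq_of_factorization_eq (Nat.mul_pos (tFun_pos N) (uFun_pos N)).ne' hN.ne' fun p => ?_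
  rw [Nat.factorization_mul (tFun_pos N).ne' (uFun_pos N).ne', Finsupp.add_apply,
    factorization_tFun, factorization_uFun]
  omega

theorem gcd_tFun_dvd {N : ℕ} (hN : 0 < N) (d : ℕ) : d.gcd (tFun N) ∣ N :=
  (Nat.gcd_dvd_right _ _).trans ⟨_, (tFun_mul_uFun hN).symm⟩

theorem uFun_dvd_div {N : ℕ} (hN : 0 < N) (d : ℕ) : uFun N ∣ N / d.gcd (tFun N) := by
  refine (Nat.dvd_div_iff_mul_dvd (gcd_tFun_dvd hN d)).2 ?_
  conv_rhs => rw [← tFun_mul_uFun hN]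
  exact Nat.mul_dvd_mul_right (Nat.gcd_dvd_right _ _) _

theorem dvd_mul_div_gcd_tFun {N : ℕ} (hN : 0 < N) (d : ℕ) : N ∣ d * (N / d.gcd (tFun N)) := by
  obtain ⟨c, hc⟩ := Nat.gcd_dvd_left d (tFun N)
  obtain ⟨k, hk⟩ := gcd_tFun_dvd hN d
  have h0 : 0 < d.gcd (tFun N) := Nat.gcd_pos_of_pos_right _ (tFun_pos N)
  have hdiv : N / d.gcd (tFun N) = k := Nat.div_eq_of_eq_mul_right h0 hk
  refine ⟨c, ?_⟩
  rw [hdiv]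
  calc d * k = d.gcd (tFun N) * c * k := by rw [← hc]
    _ = d.gcd (tFun N) * k * c := by ring
    _ = N * c := by rw [← hk]

/-- Let α ≤ β and ν ≤ α + β be the exponents of p in a, b and N. If α ≥ ⌈ν/2⌉, the quotient has
exponent ⌈ν/2⌉ ≤ α ≤ β. Otherwise α ≤ ⌊ν/2⌋ and it has exponent ν - α, which lies between α and β.
-/
theorem gcd_div_gcd_tFun {a b N : ℕ} (ha : 0 < a) (hb : 0 < b) (hab : a ∣ b) (hN : 0 < N)
    (h : N ∣ a * b) :
    a.gcd (N / (a.gcd (uFun N)).gcd (tFun N)) = a.gcd (uFun N) ∧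
      N / (a.gcd (uFun N)).gcd (tFun N) ∣ b := by
  set d := a.gcd (uFun N) with hd
  have hd0 : d ≠ 0 := (Nat.gcd_pos_of_pos_left _ ha).ne'
  have hn0 : N / d.gcd (tFun N) ≠ 0 := by
    have := Nat.div_pos (Nat.le_of_dvd hN (gcd_tFun_dvd hN d))
      (Nat.gcd_pos_of_pos_right _ (tFun_pos N))
    omega
  have hdf : ∀ p, d.factorization p = min (a.factorization p) ((N.factorization p + 1) / 2) := by
    intro p
    rw [hd, Nat.factorization_gcd ha.ne' (uFun_pos N).ne', Finsupp.inf_apply, factorization_uFun]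
  have hnf : ∀ p, (N / d.gcd (tFun N)).factorization p =
      N.factorization p - min (d.factorization p) (N.factorization p / 2) := by
    intro p
    rw [Nat.factorization_div (gcd_tFun_dvd hN d), Finsupp.tsub_apply,
      Nat.factorization_gcd hd0 (tFun_pos N).ne', Finsupp.inf_apply, factorization_tFun]
  have hab' : ∀ p, a.factorization p ≤ b.factorization p := fun p =>
    (Nat.factorization_le_iff_dvd ha.ne' hb.ne').2 hab p
  have hN' : ∀ p, N.factorization p ≤ a.factorization p + b.factorization p := fun p => by
    have := (Nat.factorization_le_iff_dvd hN.ne' (Nat.mul_pos ha hb).ne').2 h p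
    rwa [Nat.factorization_mul ha.ne' hb.ne', Finsupp.add_apply] at this
  constructor
  · refine Nat.eq_of_factorization_eq (Nat.gcd_pos_of_pos_left _ ha).ne' hd0 fun p => ?_
    rw [Nat.factorization_gcd ha.ne' hn0, Finsupp.inf_apply, hnf, hdf]
    have := hab' p
    have := hN' p
    omega
  · refine (Nat.factorization_le_iff_dvd hn0 hb.ne').1 fun p => ?_
    rw [hnf, hdf]
    have := hab' p
    have := hN' p
    omega

end FloorAndCeilOfHalfExponents

/-! ### Changes of variables and the group of points. -/

namespace WeierstrassCurve

section VariableChange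

open WeierstrassCurve.Affine

variable {F : Type*} [Field F] (C : VariableChange F) (W : WeierstrassCurve F)

theorem equation_variableChange_iff (x y : F) :
    (C • W).toAffine.Equation x y ↔
      W.toAffine.Equation (C.u ^ 2 * x + C.r) (C.u ^ 3 * y + C.u ^ 2 * C.s * x + C.t) := by
  have hu : (C.u : F) ≠ 0 := C.u.ne_zero
  rw [equation_iff', equation_iff']
  simp only [variableChange_def, Units.val_inv_eq_inv_val]
  rw [← mul_right_inj' (pow_ne_zero 6 hu), mul_zero]
  refine Eq.congr_left ?_
  field_simp
  ring

variable [DecidableEq F]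

/-- The substitution carries a line of slope λ to one of slope uλ + s, tangents included; this makes
it compatible with chord-tangent addition. -/
theorem slope_variableChange {x₁ x₂ y₁ y₂ : F}
    (hxy : ¬(x₁ = x₂ ∧ y₁ = (C • W).toAffine.negY x₂ y₂))
    (h₁ : (C • W).toAffine.Equation x₁ y₁) (h₂ : (C • W).toAffine.Equation x₂ y₂) :
    W.toAffine.slope (C.u ^ 2 * x₁ + C.r) (C.u ^ 2 * x₂ + C.r)
      (C.u ^ 3 * y₁ + C.u ^ 2 * C.s * x₁ + C.t) (C.u ^ 3 * y₂ + C.u ^ 2 * C.s * x₂ + C.t) =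
      C.u * (C • W).toAffine.slope x₁ x₂ y₁ y₂ + C.s := by
  have hu : (C.u : F) ≠ 0 := C.u.ne_zero
  by_cases hx : x₁ = x₂
  · have hy : y₁ ≠ (C • W).toAffine.negY x₂ y₂ := fun h => hxy ⟨hx, h⟩
    obtain rfl : y₁ = y₂ := Y_eq_of_Y_ne h₁ h₂ hx hy
    subst hx
    have hd : y₁ - (C • W).toAffine.negY x₁ y₁ ≠ 0 := sub_ne_zero.2 hy
    have key : (C.u ^ 3 * y₁ + C.u ^ 2 * C.s * x₁ + C.t) - W.toAffine.negY (C.u ^ 2 * x₁ + C.r)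
        (C.u ^ 3 * y₁ + C.u ^ 2 * C.s * x₁ + C.t) =
        C.u ^ 3 * (y₁ - (C • W).toAffine.negY x₁ y₁) := by
      simp only [negY, variableChange_def, Units.val_inv_eq_inv_val]
      field_simp
      ring
    have hd' : (C.u ^ 3 * y₁ + C.u ^ 2 * C.s * x₁ + C.t) - W.toAffine.negY (C.u ^ 2 * x₁ + C.r)
        (C.u ^ 3 * y₁ + C.u ^ 2 * C.s * x₁ + C.t) ≠ 0 := by
      rw [key]; exact mul_ne_zero (pow_ne_zero _ hu) hd
    rw [slope_of_Y_ne rfl (sub_ne_zero.1 hd'), slope_of_Y_ne rfl hy, key]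
    have hmul : ∀ n D : F, D ≠ 0 → (C.u * (n / D) + C.s) * (C.u ^ 3 * D) =
        C.u ^ 4 * n + C.s * C.u ^ 3 * D := fun n D hD => by field_simp
    rw [div_eq_iff (mul_ne_zero (pow_ne_zero _ hu) hd), hmul _ _ hd]
    simp only [negY, variableChange_def, Units.val_inv_eq_inv_val]
    field_simp
    ring
  · have hx' : (C.u : F) ^ 2 * x₁ + C.r ≠ C.u ^ 2 * x₂ + C.r := fun h =>
      hx (mul_left_cancel₀ (pow_ne_zero 2 hu) (add_right_cancel h))
    have hd : x₁ - x₂ ≠ 0 := sub_ne_zero.2 hx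
    have hd' : (C.u : F) ^ 2 * x₁ + C.r - (C.u ^ 2 * x₂ + C.r) = C.u ^ 2 * (x₁ - x₂) := by ring
    rw [slope_of_X_ne hx', slope_of_X_ne hx, hd']
    field_simp
    ring

variable [W.IsElliptic]

/-- A change of variables induces an isomorphism of the groups of points. -/
noncomputable def pointVariableChangeHom : (C • W).toAffine.Point →+ W.toAffine.Point where
  toFun P := match P with
    | 0 => 0
    | .some x y h => .some (C.u ^ 2 * x + C.r) (C.u ^ 3 * y + C.u ^ 2 * C.s * x + C.t)
        (equation_iff_nonsingular.1 ((equation_variableChange_iff C W x y).1 h.1))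
  map_zero' := rfl
  map_add' := by
    rintro (_ | ⟨x₁, y₁, h₁⟩) (_ | ⟨x₂, y₂, h₂⟩)
    any_goals rfl
    have hu : (C.u : F) ≠ 0 := C.u.ne_zero
    have hneg : ∀ x y : F, W.toAffine.negY (C.u ^ 2 * x + C.r)
        (C.u ^ 3 * y + C.u ^ 2 * C.s * x + C.t) =
        C.u ^ 3 * (C • W).toAffine.negY x y + C.u ^ 2 * C.s * x + C.t := by
      intro x y
      simp only [negY, variableChange_def, Units.val_inv_eq_inv_val]
      field_simp
      ring
    by_cases hxy : x₁ = x₂ ∧ y₁ = (C • W).toAffine.negY x₂ y₂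
    · rw [Point.add_of_Y_eq hxy.1 hxy.2]
      refine (Point.add_of_Y_eq (by rw [hxy.1]) ?_).symm
      rw [hneg, hxy.1, hxy.2]
    · have hxy' : ¬((C.u : F) ^ 2 * x₁ + C.r = C.u ^ 2 * x₂ + C.r ∧
          C.u ^ 3 * y₁ + C.u ^ 2 * C.s * x₁ + C.t = W.toAffine.negY (C.u ^ 2 * x₂ + C.r)
            (C.u ^ 3 * y₂ + C.u ^ 2 * C.s * x₂ + C.t)) := by
        rintro ⟨hx, hy⟩
        obtain rfl := mul_left_cancel₀ (pow_ne_zero 2 hu) (add_right_cancel hx)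
        rw [hneg] at hy
        exact hxy ⟨rfl, mul_left_cancel₀ (pow_ne_zero 3 hu)
          (add_right_cancel (add_right_cancel hy))⟩
      rw [Point.add_some hxy]
      refine Eq.trans ?_ (Point.add_some hxy').symm
      rw [Point.some.injEq, slope_variableChange C W hxy h₁.1 h₂.1]
      simp only [addX, addY, negAddY, negY, variableChange_def, Units.val_inv_eq_inv_val]
      constructor
      · field_simp
        ring
      · field_simp
        ring

theorem pointVariableChangeHom_bijective : Function.Bijective (pointVariableChangeHom C W) := by
  have hu : (C.u : F) ≠ 0 := C.u.ne_zero
  refine ⟨(injective_iff_map_eq_zero _).2 ?_, ?_⟩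
  · rintro (_ | ⟨x, y, h⟩) h0
    · rfl
    · cases h0
  · rintro (_ | ⟨x, y, h⟩)
    · exact ⟨0, rfl⟩
    · have hx : (C.u : F) ^ 2 * ((x - C.r) / C.u ^ 2) + C.r = x := by field_simp; ring
      have hy : (C.u : F) ^ 3 * ((y - C.s * (x - C.r) - C.t) / C.u ^ 3) +
          C.u ^ 2 * C.s * ((x - C.r) / C.u ^ 2) + C.t = y := by field_simp; ring
      refine ⟨.some _ _ (equation_iff_nonsingular.1 ((equation_variableChange_iff C W
        ((x - C.r) / C.u ^ 2) ((y - C.s * (x - C.r) - C.t) / C.u ^ 3)).2 ?_)), ?_⟩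
      · rw [hx, hy]
        exact h.1
      · exact Point.some.injEq .. |>.mpr ⟨hx, hy⟩

end VariableChange

end WeierstrassCurve

/-! ### The x-coordinates of P + Q and P - Q in terms of those of P and Q. -/

namespace WeierstrassCurve.Affine.Point

open MvPolynomial

variable {K : Type*} [Field K] {W : Affine K}

theorem _root_.WeierstrassCurve.Affine.eval_addSubMap {R : Type*} [CommRing R] (W : Affine R)
    (v : Fin 3 → R) (i : Fin 3) : (addSubMap W i).eval v =
    ![v 0 ^ 2 - W.b₄ * v 0 * v 2 - W.b₆ * v 1 * v 2 - W.b₈ * v 2 ^ 2,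
      2 * v 1 * v 0 + W.b₂ * v 0 * v 2 + W.b₄ * v 1 * v 2 + W.b₆ * v 2 ^ 2,
      v 1 ^ 2 - 4 * v 0 * v 2] i := by
  fin_cases i <;> simp [addSubMap]

variable [DecidableEq K]

/-- The slopes l, m of the lines through P, Q and through P, -Q enter symmetrically. Both (x₁ -
x₂)(l + m) and (x₁ - x₂)lm are polynomials free of y₂; for the latter, one factor x₁ - x₂ cancels in
the difference of the two curve equations. -/
theorem addSubMap_sym2x_of_X_ne {x₁ x₂ y₁ y₂ : K} {h₁ : W.Nonsingular x₁ y₁}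
    {h₂ : W.Nonsingular x₂ y₂} (hx : x₁ ≠ x₂) (i : Fin 3) :
    (addSubMap W i).eval ((some _ _ h₁).sym2x (some _ _ h₂)) =
      (x₁ - x₂) ^ 2 * (some _ _ h₁ + some _ _ h₂).sym2x (some _ _ h₁ - some _ _ h₂) i := by
  have e₁ := (equation_iff' _ _).1 h₁.1
  have e₂ := (equation_iff' _ _).1 h₂.1
  have hd : x₁ - x₂ ≠ 0 := sub_ne_zero.2 hx
  rw [sub_eq_add_neg (some _ _ h₁), eval_addSubMap W, neg_some, add_of_X_ne hx, add_of_X_ne hx, sym2x_some_some,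
    sym2x_some_some, slope_of_X_ne hx, slope_of_X_ne hx]
  obtain ⟨l, hl⟩ : ∃ l, l = (y₁ - y₂) / (x₁ - x₂) := ⟨_, rfl⟩
  obtain ⟨m, hm⟩ : ∃ m, m = (y₁ - W.negY x₂ y₂) / (x₁ - x₂) := ⟨_, rfl⟩
  rw [← hl, ← hm]
  rw [eq_div_iff hd] at hl hm
  have hsum : (x₁ - x₂) * (l + m) = 2 * y₁ + W.a₁ * x₂ + W.a₃ := by
    rw [negY] at hm
    linear_combination hl + hm
  have hprod : (x₁ - x₂) * (l * m) =
      x₁ ^ 2 + x₁ * x₂ + x₂ ^ 2 + W.a₂ * (x₁ + x₂) + W.a₄ - W.a₁ * y₁ := by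
    rw [negY] at hm
    apply mul_left_cancel₀ hd
    linear_combination hl * m * (x₁ - x₂) + hm * (y₁ - y₂) + e₁ - e₂
  generalize hp : (x₁ - x₂) * (l * m) = p at hprod
  generalize hs : (x₁ - x₂) * (l + m) = s at hsum
  have hS : (x₁ - x₂) ^ 2 * (W.addX x₁ x₂ l + W.addX x₁ x₂ m) =
      s ^ 2 - 2 * (x₁ - x₂) * p + W.a₁ * (x₁ - x₂) * s
        - 2 * (W.a₂ + x₁ + x₂) * (x₁ - x₂) ^ 2 := by
    rw [← hp, ← hs, addX, addX]; ring
  have hP : (x₁ - x₂) ^ 2 * (W.addX x₁ x₂ l * W.addX x₁ x₂ m) =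
      p ^ 2 + W.a₁ * p * s - (W.a₂ + x₁ + x₂) * (s ^ 2 - 2 * (x₁ - x₂) * p)
        + W.a₁ ^ 2 * (x₁ - x₂) * p - (W.a₂ + x₁ + x₂) * W.a₁ * (x₁ - x₂) * s
        + (W.a₂ + x₁ + x₂) ^ 2 * (x₁ - x₂) ^ 2 := by
    rw [← hp, ← hs, addX, addX]; ring
  fin_cases i
  · simp only [Fin.zero_eta, Fin.isValue, Matrix.cons_val]
    rw [hP, hsum, hprod, b₄, b₆, b₈]
    linear_combination (W.a₁ ^ 2 + 4 * (W.a₂ + x₁ + x₂)) * e₁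
  · simp only [Fin.mk_one, Fin.isValue, Matrix.cons_val]
    rw [hS, hsum, hprod, b₂, b₄, b₆]
    linear_combination (-4) * e₁
  · simp only [Fin.reduceFinMk, Fin.isValue, Matrix.cons_val]
    ring

theorem addSubMap_sym2x_self [W.IsElliptic] (Q : W.Point) : ∃ c ≠ 0, ∀ i,
    (addSubMap W i).eval (Q.sym2x Q) = c * (Q + Q).sym2x 0 i := by
  rcases Q with _ | ⟨x, y, h⟩
  · refine ⟨1, one_ne_zero, fun i => ?_⟩
    change _ = 1 * (0 + 0 : W.Point).sym2x 0 i
    rw [← zero_def, eval_addSubMap W, add_zero, sym2x_zero_zero]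
    fin_cases i <;> simp
  · have e := (equation_iff' _ _).1 h.1
    by_cases hy : y = W.negY x y
    · have hΨ : 4 * x ^ 3 + W.b₂ * x ^ 2 + 2 * W.b₄ * x + W.b₆ = 0 := by
        rw [negY] at hy
        rw [b₂, b₄, b₆]
        linear_combination (2 * y + W.a₁ * x + W.a₃) * hy - 4 * e
      have h1 : (addSubMap W 1).eval ((some x y h).sym2x (some x y h)) = 0 := by
        rw [eval_addSubMap W, sym2x_some_some]
        simp only [Fin.isValue, Matrix.cons_val]
        linear_combination hΨ
      have h2 : (addSubMap W 2).eval ((some x y h).sym2x (some x y h)) = 0 := by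
        rw [eval_addSubMap W, sym2x_some_some]
        simp only [Fin.isValue, Matrix.cons_val]
        ring
      refine ⟨(addSubMap W 0).eval ((some x y h).sym2x (some x y h)), fun h0 => ?_, fun i => ?_⟩
      · refine addSubMap_ne_zero W (sym2x_ne_zero (some x y h) (some x y h)) (funext fun i => ?_)
        fin_cases i
        exacts [h0, h1, h2]
      · rw [add_self_of_Y_eq hy, sym2x_zero_zero]
        fin_cases i
        · simp
        · simpa using h1
        · simpa using h2
    · have hd : y - W.negY x y ≠ 0 := sub_ne_zero.2 hy
      refine ⟨(y - W.negY x y) ^ 2, pow_ne_zero 2 hd, fun i => ?_⟩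
      rw [add_self_of_Y_ne hy, eval_addSubMap W, sym2x_some_some, sym2x_some_zero,
        slope_of_Y_ne rfl hy]
      obtain ⟨l, hl⟩ : ∃ l, l = (3 * x ^ 2 + 2 * W.a₂ * x + W.a₄ - W.a₁ * y) / (y - W.negY x y) :=
        ⟨_, rfl⟩
      rw [← hl]
      rw [eq_div_iff hd] at hl
      have hX : (y - W.negY x y) ^ 2 * W.addX x x l =
          (3 * x ^ 2 + 2 * W.a₂ * x + W.a₄ - W.a₁ * y) ^ 2
          + W.a₁ * (3 * x ^ 2 + 2 * W.a₂ * x + W.a₄ - W.a₁ * y) * (y - W.negY x y)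
          - (W.a₂ + 2 * x) * (y - W.negY x y) ^ 2 := by
        rw [← hl, addX]; ring
      fin_cases i
      · simp only [Fin.zero_eta, Fin.isValue, Matrix.cons_val]
        rw [hX, negY, b₄, b₆, b₈]
        linear_combination (W.a₁ ^ 2 + 4 * (W.a₂ + 2 * x)) * e
      · simp only [Fin.mk_one, Fin.isValue, Matrix.cons_val]
        rw [negY, b₂, b₄, b₆]
        linear_combination (-4) * e
      · simp only [Fin.reduceFinMk, Fin.isValue, Matrix.cons_val]
        ring

/-- The map `addSubMap` sends `(x(P)x(Q) : x(P)+x(Q) : 1)` to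
`(x(P+Q)x(P-Q) : x(P+Q)+x(P-Q) : 1)`. -/
theorem addSubMap_sym2x [W.IsElliptic] (P Q : W.Point) : ∃ c ≠ 0, ∀ i,
    (addSubMap W i).eval (P.sym2x Q) = c * (P + Q).sym2x (P - Q) i := by
  by_cases hPQ : P = Q
  · subst hPQ
    rw [sub_self]
    exact addSubMap_sym2x_self P
  by_cases hPQ' : P = -Q
  · obtain rfl : Q = -P := by rw [hPQ', neg_neg]
    rw [add_neg_cancel, sub_neg_eq_add, sym2x_neg_right, sym2x_comm 0]
    exact addSubMap_sym2x_self P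
  rcases P with _ | ⟨x₁, y₁, h₁⟩
  · refine ⟨1, one_ne_zero, fun i => ?_⟩
    rw [← zero_def, zero_add, zero_sub, sym2x_neg_right, eval_addSubMap W, one_mul]
    rcases Q with _ | ⟨x₂, y₂, h₂⟩
    · exact absurd rfl hPQ
    · rw [sym2x_zero_some, sym2x_some_some]
      fin_cases i <;> simp <;> ring
  rcases Q with _ | ⟨x₂, y₂, h₂⟩
  · refine ⟨1, one_ne_zero, fun i => ?_⟩
    rw [← zero_def, add_zero, sub_zero, eval_addSubMap W, one_mul, sym2x_some_zero, sym2x_some_some]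
    fin_cases i <;> simp <;> ring
  have hx : x₁ ≠ x₂ := by
    rintro rfl
    rcases eq_or_eq_neg_of_xRep_eq_xRep (P := some _ _ h₁) (Q := some _ _ h₂) (by simp) with h | h
    exacts [hPQ h, hPQ' h]
  exact ⟨_, pow_ne_zero 2 (sub_ne_zero.2 hx), addSubMap_sym2x_of_X_ne hx⟩

end WeierstrassCurve.Affine.Point

/-! ### The function field: degrees over F(r), and embeddings defined by points. -/

section

open Polynomial WeierstrassCurve WeierstrassCurve.Affine
open scoped IntermediateField RatFunc Polynomial.Bivariate

/-- F(z) lies in the fixed field of H, over which K has degree #H. If K is infinite over F(z), the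
`finrank` is 0 and the claim is empty. -/
theorem IntermediateField.card_dvd_finrank_adjoin_of_fixed {F K : Type*} [Field F] [Field K]
    [Algebra F K] (H : Subgroup Gal(K/F)) [Finite H] {z : K} (hz : ∀ σ ∈ H, σ z = z) :
    Nat.card H ∣ Module.finrank F⟮z⟯ K := by
  have := Fintype.ofFinite H
  have h : Module.finrank (IntermediateField.fixedField H) K = Nat.card H := by
    rw [Nat.card_eq_fintype_card]
    exact FixedPoints.finrank_eq_card H K
  rw [← h]
  refine IntermediateField.finrank_dvd_of_le_left ?_
  rw [IntermediateField.adjoin_simple_le_iff, IntermediateField.mem_fixedField_iff]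
  exact hz

namespace WeierstrassCurve.Affine

noncomputable section

variable {F : Type*} [Field F] (W : Affine F)

namespace FunctionField

instance : FaithfulSMul F[X] W.FunctionField :=
  FaithfulSMul.trans F[X] W.CoordinateRing W.FunctionField

/-- The coordinate function `x`. -/
def x : W.FunctionField := algebraMap F[X] W.FunctionField X

/-- The coordinate function `y`. -/
def y : W.FunctionField := algebraMap W.CoordinateRing W.FunctionField (CoordinateRing.mk W Y)

theorem finrank_ratFunc : Module.finrank F⟮X⟯ W.FunctionField = 2 := by
  rw [IsFractionRing.finrank_eq F[X] F⟮X⟯ W.CoordinateRing W.FunctionField,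
    Module.finrank_eq_card_basis (CoordinateRing.basis W), Fintype.card_fin]

/-- The embedding of the rational function field into the function field. -/
def ofRatFunc : F⟮X⟯ →ₐ[F] W.FunctionField := IsScalarTower.toAlgHom F F⟮X⟯ W.FunctionField

/-- Multiplicativity in the tower F(r) ⊆ F(x) ⊆ K. For constant r both sides are 0. -/
theorem finrank_adjoin_ofRatFunc (r : F⟮X⟯) :
    Module.finrank F⟮ofRatFunc W r⟯ W.FunctionField = 2 * max r.num.natDegree r.denom.natDegree := by
  rw [← RatFunc.finrank_eq_max_natDegree, ← finrank_ratFunc W, mul_comm,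
    Module.finrank_mul_finrank F⟮r⟯ F⟮X⟯ W.FunctionField]
  have h : F⟮r⟯.map (ofRatFunc W) = F⟮ofRatFunc W r⟯ := by
    rw [IntermediateField.adjoin_map, Set.image_singleton]
  rw [← h]
  exact (Algebra.finrank_eq_of_equiv_equiv (F⟮r⟯.equivMap (ofRatFunc W)).toRingEquiv
    (RingEquiv.refl W.FunctionField) (by ext; rfl)).symm

theorem transcendental_x : Transcendental F (x W) := by
  rw [x, transcendental_algebraMap_iff (FaithfulSMul.algebraMap_injective _ _)]
  exact Polynomial.transcendental_X F

theorem algHom_ext {L : Type*} [Field L] [Algebra F L] {φ ψ : W.FunctionField →ₐ[F] L}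
    (hx : φ (x W) = ψ (x W)) (hy : φ (y W) = ψ (y W)) : φ = ψ := by
  apply AlgHom.coe_ringHom_injective
  apply IsLocalization.ringHom_ext (nonZeroDivisors W.CoordinateRing)
  apply AdjoinRoot.ringHom_ext
  · apply Polynomial.ringHom_ext
    · intro a
      exact (φ.commutes a).trans (ψ.commutes a).symm
    · exact hx
  · exact hy

variable {W} {L : Type*} [Field L] [Algebra F L]

/-- Evaluation of regular functions at a point. -/
def evalHom {a b : L} (h : (W⁄L).Equation a b) : W.CoordinateRing →ₐ[F] L :=
  AdjoinRoot.liftAlgHom W.polynomial (Polynomial.aeval a) b <| by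
    have h' : b ^ 2 + algebraMap F L W.a₁ * a * b + algebraMap F L W.a₃ * b -
        (a ^ 3 + algebraMap F L W.a₂ * a ^ 2 + algebraMap F L W.a₄ * a + algebraMap F L W.a₆) = 0 :=
      (equation_iff' _ _).1 h
    simp only [WeierstrassCurve.Affine.polynomial, eval₂_add, eval₂_sub, eval₂_mul, eval₂_pow,
      eval₂_X, eval₂_C, RingHom.coe_coe, map_add, map_mul, map_pow, aeval_X, aeval_C]
    rw [← h']
    ring

/-- A nonzero regular function divides a nonzero polynomial in x, which cannot vanish at a
transcendental element. -/
theorem evalHom_injective {a b : L} (h : (W⁄L).Equation a b) (ha : Transcendental F a) :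
    Function.Injective (evalHom h) := by
  rw [injective_iff_map_eq_zero]
  intro f hf
  by_contra hf0
  have : Module.Finite F[X] W.CoordinateRing := .of_basis (CoordinateRing.basis W)
  obtain ⟨p, hp, g, hg⟩ := (Algebra.IsAlgebraic.isAlgebraic (R := F[X]) f).exists_nonzero_dvd
    (mem_nonZeroDivisors_of_ne_zero hf0)
  have h1 : Polynomial.aeval a p = 0 := by
    have := congrArg (evalHom h) hg
    rw [map_mul, hf, zero_mul] at this
    rw [← this]
    exact (AdjoinRoot.liftAlgHom_of ..).symm
  exact hp (transcendental_iff.1 ha _ h1)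

/-- The embedding of function fields attached to a nonconstant point. -/
def evalFieldHom {a b : L} (h : (W⁄L).Equation a b) (ha : Transcendental F a) :
    W.FunctionField →ₐ[F] L :=
  IsFractionRing.liftAlgHom (evalHom_injective h ha)

theorem evalFieldHom_x {a b : L} (h : (W⁄L).Equation a b) (ha : Transcendental F a) :
    evalFieldHom h ha (x W) = a := by
  rw [x, IsScalarTower.algebraMap_apply F[X] W.CoordinateRing W.FunctionField, evalFieldHom,
    IsFractionRing.coe_liftAlgHom, IsFractionRing.lift_algebraMap]
  exact (AdjoinRoot.liftAlgHom_of ..).trans (Polynomial.aeval_X a)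

theorem evalFieldHom_y {a b : L} (h : (W⁄L).Equation a b) (ha : Transcendental F a) :
    evalFieldHom h ha (y W) = b := by
  rw [y, evalFieldHom, IsFractionRing.coe_liftAlgHom, IsFractionRing.lift_algebraMap]
  exact AdjoinRoot.liftAlgHom_root ..

end FunctionField

end

end WeierstrassCurve.Affine

end

/-! ### The generic point; negation and translations as automorphisms of K. -/

section

open Polynomial WeierstrassCurve WeierstrassCurve.Affine
open scoped IntermediateField RatFunc Polynomial.Bivariate

namespace WeierstrassCurve.Affine

noncomputable section

variable {F : Type*} [Field F] (W : Affine F)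

namespace FunctionField

instance [W.IsElliptic] (L : Type*) [Field L] [Algebra F L] : (W⁄L).IsElliptic :=
  inferInstanceAs (WeierstrassCurve.map W (algebraMap F L)).IsElliptic

theorem equation_generic : (W⁄W.FunctionField).Equation (x W) (y W) := by
  rw [equation_iff']
  have h : algebraMap W.CoordinateRing W.FunctionField (CoordinateRing.mk W W.polynomial) = 0 := by
    rw [AdjoinRoot.mk_self, map_zero]
  have hC : ∀ p : F[X], algebraMap W.CoordinateRing W.FunctionField (CoordinateRing.mk W (C p)) =
      algebraMap F[X] W.FunctionField p := fun p =>
    (IsScalarTower.algebraMap_apply F[X] W.CoordinateRing W.FunctionField p).symm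
  have hCC : ∀ c : F, algebraMap F[X] W.FunctionField (C c) = algebraMap F W.FunctionField c :=
    fun c => (IsScalarTower.algebraMap_apply F F[X] W.FunctionField c).symm
  simp only [WeierstrassCurve.Affine.polynomial, map_add, map_sub, map_mul, map_pow, hC, hCC] at h
  rw [← h]
  simp only [x, y, baseChange_a₁, baseChange_a₂, baseChange_a₃, baseChange_a₄, baseChange_a₆]
  ring

variable [W.IsElliptic]

/-- The generic point of an elliptic curve. -/
def generic : (W⁄W.FunctionField).Point :=
  .some (x W) (y W) (equation_iff_nonsingular.1 (equation_generic W))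

/-- Otherwise 4x³ + b₂x² + 2b₄x + b₆ = 0 with x transcendental, so b₂ = 2b₄ = b₆ = 0 and Δ = 0, in
any characteristic. -/
theorem y_ne_negY : y W ≠ (W⁄W.FunctionField).negY (x W) (y W) := by
  intro h
  have heq := (equation_iff' _ _).1 (equation_generic W)
  rw [negY] at h
  have hΨ : Polynomial.aeval (x W)
      (C 4 * X ^ 3 + C W.b₂ * X ^ 2 + C (2 * W.b₄) * X + C W.b₆ : F[X]) = 0 := by
    simp only [map_add, map_mul, map_pow, aeval_X, aeval_C, map_ofNat, WeierstrassCurve.b₂,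
      WeierstrassCurve.b₄, WeierstrassCurve.b₆]
    simp only [baseChange_a₁, baseChange_a₂, baseChange_a₃, baseChange_a₄, baseChange_a₆]
      at h heq
    linear_combination (2 * y W + algebraMap F _ W.a₁ * x W + algebraMap F _ W.a₃) * h - 4 * heq
  have h0 := (transcendental_iff.1 (transcendental_x W)) _ hΨ
  have h₂ : W.b₂ = 0 := by simpa [coeff_X, coeff_C] using congrArg (coeff · 2) h0
  have h₄ : 2 * W.b₄ = 0 := by simpa [coeff_X, coeff_C] using congrArg (coeff · 1) h0
  have h₆ : W.b₆ = 0 := by simpa [coeff_X, coeff_C] using congrArg (coeff · 0) h0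
  refine W.isUnit_Δ.ne_zero ?_
  rw [WeierstrassCurve.Δ, h₂, h₆]
  linear_combination (-4 * W.b₄ ^ 2) * h₄

theorem generic_ne_neg [DecidableEq W.FunctionField] : generic W ≠ -generic W := by
  rw [generic, Point.neg_some, Ne, Point.some.injEq]
  exact fun h => y_ne_negY W h.2

end FunctionField

open WeierstrassCurve.Affine.FunctionField

variable [DecidableEq F] [DecidableEq W.FunctionField]

open scoped Classical in
/-- The points over the function field with constant coordinates. -/
def constantPoints : AddSubgroup (W⁄W.FunctionField).Point :=
  (Point.map (W' := W) (algebraicClosure F W.FunctionField).val).range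

/-- The group homomorphism from `E(F)` to `E(K)`. -/
def constantPoint : (W⁄F).Point →+ (W⁄W.FunctionField).Point :=
  Point.map (Algebra.ofId F W.FunctionField)

theorem constantPoint_mem (P : (W⁄F).Point) : constantPoint W P ∈ constantPoints W :=
  ⟨Point.map (Algebra.ofId F (algebraicClosure F W.FunctionField)) P, by
    rw [Point.map_map, constantPoint]
    congr 1⟩

theorem constantPoint_injective : Function.Injective (constantPoint W) :=
  Point.map_injective _

variable [W.IsElliptic]

theorem generic_notMem : generic W ∉ constantPoints W := by
  rintro ⟨_ | ⟨a, b, h⟩, hP⟩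
  · cases hP
  · rw [generic, Point.map_some, Point.some.injEq] at hP
    have ha := a.2
    rw [mem_algebraicClosure_iff] at ha
    exact transcendental_x W (hP.1 ▸ ha)

/-- The second coordinate is a root of a monic quadratic over the constants. Taking the algebraic
closure of F in K as constants avoids having to show that it equals F. -/
theorem some_mem_constantPoints {a b : W.FunctionField} (h : (W⁄W.FunctionField).Nonsingular a b)
    (ha : IsAlgebraic F a) : .some a b h ∈ constantPoints W := by
  have hb : IsAlgebraic F b := by
    have h' : b ^ 2 + algebraMap F _ W.a₁ * a * b + algebraMap F _ W.a₃ * b -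
        (a ^ 3 + algebraMap F _ W.a₂ * a ^ 2 + algebraMap F _ W.a₄ * a + algebraMap F _ W.a₆) = 0 :=
      (equation_iff' _ _).1 h.1
    let L := algebraicClosure F W.FunctionField
    let a' : L := ⟨a, mem_algebraicClosure_iff.2 ha⟩
    have hp : ∀ c d : L, X ^ 2 + C c * X - C d ≠ 0 := fun c d hp => by
      simpa [coeff_X, coeff_C] using congrArg (coeff · 2) hp
    refine IsAlgebraic.restrictScalars F (⟨_, hp
      (algebraMap F L W.a₁ * a' + algebraMap F L W.a₃)
      (a' ^ 3 + algebraMap F L W.a₂ * a' ^ 2 + algebraMap F L W.a₄ * a' + algebraMap F L W.a₆),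
      ?_⟩ : IsAlgebraic L b)
    simp only [map_sub, map_add, map_mul, map_pow, aeval_X, aeval_C,
      ← IsScalarTower.algebraMap_apply F L W.FunctionField, IntermediateField.algebraMap_apply]
    rw [← h']
    ring
  refine ⟨.some ⟨a, mem_algebraicClosure_iff.2 ha⟩ ⟨b, mem_algebraicClosure_iff.2 hb⟩
    ((W.baseChange_nonsingular (algebraicClosure F W.FunctionField).val.injective ..).1 h), rfl⟩

variable {W}

theorem exists_algHom_map_generic {P : (W⁄W.FunctionField).Point} (hP : P ∉ constantPoints W) :
    ∃ φ : W.FunctionField →ₐ[F] W.FunctionField, Point.map (W' := W) φ (generic W) = P := by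
  rcases P with _ | ⟨a, b, h⟩
  · exact absurd (zero_mem _) hP
  · have ha : Transcendental F a := fun ha => hP (some_mem_constantPoints W h ha)
    refine ⟨evalFieldHom h.1 ha, ?_⟩
    rw [generic, Point.map_some, Point.some.injEq]
    exact ⟨evalFieldHom_x h.1 ha, evalFieldHom_y h.1 ha⟩

theorem algHom_ext_generic {φ ψ : W.FunctionField →ₐ[F] W.FunctionField}
    (h : Point.map (W' := W) φ (generic W) = Point.map (W' := W) ψ (generic W)) : φ = ψ := by
  rw [generic, Point.map_some, Point.map_some, Point.some.injEq] at h
  exact algHom_ext W h.1 h.2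

theorem map_constantPoint (φ : W.FunctionField →ₐ[F] W.FunctionField) (P : (W⁄F).Point) :
    Point.map (W' := W) φ (constantPoint W P) = constantPoint W P := by
  rw [constantPoint, Point.map_map, Subsingleton.elim (φ.comp _)]

theorem exists_algEquiv_of_leftInverse {P : (W⁄W.FunctionField).Point}
    {φ ψ : W.FunctionField →ₐ[F] W.FunctionField} (hφ : Point.map (W' := W) φ (generic W) = P)
    (h₁ : Point.map (W' := W) ψ (Point.map (W' := W) φ (generic W)) = generic W)
    (h₂ : Point.map (W' := W) φ (Point.map (W' := W) ψ (generic W)) = generic W) :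
    ∃ σ : Gal(W.FunctionField/F), Point.map (W' := W) (σ : W.FunctionField →ₐ[F] W.FunctionField)
      (generic W) = P := by
  have hid : ∀ P : (W⁄W.FunctionField).Point,
      Point.map (W' := W) (AlgHom.id F W.FunctionField) P = P := by rintro (_ | _) <;> rfl
  refine ⟨AlgEquiv.ofAlgHom φ ψ ?_ ?_, hφ⟩
  · apply algHom_ext_generic
    rw [← Point.map_map, hid, h₂]
  · apply algHom_ext_generic
    rw [← Point.map_map, hid, h₁]

variable (W)

theorem exists_neg : ∃ σ : Gal(W.FunctionField/F),
    Point.map (W' := W) (σ : W.FunctionField →ₐ[F] W.FunctionField) (generic W) = -generic W := by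
  obtain ⟨φ, hφ⟩ := exists_algHom_map_generic (P := -generic W)
    fun h => generic_notMem W (by simpa using neg_mem h)
  exact exists_algEquiv_of_leftInverse hφ (by rw [hφ, map_neg, hφ, neg_neg])
    (by rw [hφ, map_neg, hφ, neg_neg])

theorem exists_translation (P : (W⁄F).Point) : ∃ σ : Gal(W.FunctionField/F),
    Point.map (W' := W) (σ : W.FunctionField →ₐ[F] W.FunctionField) (generic W) =
      generic W + constantPoint W P := by
  have h : ∀ P, generic W + constantPoint W P ∉ constantPoints W := fun P h =>
    generic_notMem W (by simpa using sub_mem h (constantPoint_mem W P))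
  obtain ⟨φ, hφ⟩ := exists_algHom_map_generic (h P)
  obtain ⟨ψ, hψ⟩ := exists_algHom_map_generic (h (-P))
  refine exists_algEquiv_of_leftInverse hφ (ψ := ψ) ?_ ?_
  · rw [hφ, map_add, hψ, map_constantPoint, map_neg, neg_add_cancel_right]
  · rw [hψ, map_add, hφ, map_constantPoint, map_neg, add_neg_cancel_right]

end

end WeierstrassCurve.Affine

end

/-! ### Primitive polynomial vectors, heights and the parallelogram law. -/

section

open Polynomial WeierstrassCurve WeierstrassCurve.Affine
open scoped IntermediateField RatFunc Polynomial.Bivariate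

section PrimitiveVectors

variable {F : Type*} [Field F]

/-- The entries of the vector have degree at most `N`, with equality for at least one of them. -/
def TopDegree {ι : Type*} (v : ι → F[X]) (N : ℕ) : Prop :=
  (∀ i, (v i).natDegree ≤ N) ∧ ∃ i, (v i).coeff N ≠ 0

theorem dvd_of_mul_eq_mul_of_span_eq_top {ι R : Type*} [CommRing R] {v w : ι → R}
    (hw : Ideal.span (Set.range w) = ⊤) {p q : R} (h : ∀ i, p * w i = q * v i) : q ∣ p := by
  have : ∀ z ∈ Ideal.span (Set.range w), q ∣ p * z := by
    intro z hz
    induction hz using Submodule.span_induction with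
    | mem z hz =>
      obtain ⟨i, rfl⟩ := hz
      exact ⟨v i, h i⟩
    | zero => simp
    | add a b _ _ ha hb => rw [mul_add]; exact dvd_add ha hb
    | smul a b _ hb => rw [smul_eq_mul, mul_left_comm]; exact hb.mul_left a
  simpa using this 1 (hw ▸ Submodule.mem_top)

/-- Proportional primitive vectors differ by a unit of F[X]. -/
theorem natDegree_eq_of_mul_eq_mul {ι : Type*} {v w : ι → F[X]}
    (hv : Ideal.span (Set.range v) = ⊤) (hw : Ideal.span (Set.range w) = ⊤) {p q : F[X]}
    (hq : q ≠ 0) (h : ∀ i, p * w i = q * v i) (i : ι) : (v i).natDegree = (w i).natDegree := by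
  obtain ⟨u, rfl⟩ := associated_of_dvd_dvd (dvd_of_mul_eq_mul_of_span_eq_top hw h)
    (dvd_of_mul_eq_mul_of_span_eq_top hv fun i => (h i).symm)
  have hi := h i
  rw [mul_assoc] at hi
  rw [← mul_left_cancel₀ hq hi]
  exact natDegree_eq_of_degree_eq (degree_eq_degree_of_associated
    (associated_unit_mul_left (w i) (u : F[X]) u.isUnit))

theorem TopDegree.unique {ι : Type*} {v w : ι → F[X]} {M N : ℕ} (hv : TopDegree v N)
    (hw : TopDegree w M) (h : ∀ i, (v i).natDegree = (w i).natDegree) : N = M := by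
  obtain ⟨i, hi⟩ := hv.2
  obtain ⟨j, hj⟩ := hw.2
  refine le_antisymm ?_ ?_
  · exact (le_natDegree_of_ne_zero hi).trans (h i ▸ hw.1 i)
  · exact (le_natDegree_of_ne_zero hj).trans (h j ▸ hv.1 j)

theorem IsCoprime.coeff_max_natDegree {a b : F[X]} (h : IsCoprime a b) :
    a.coeff (max a.natDegree b.natDegree) ≠ 0 ∨ b.coeff (max a.natDegree b.natDegree) ≠ 0 := by
  wlog hab : a.natDegree ≤ b.natDegree generalizing a b
  · rw [max_comm]
    exact (this h.symm (le_of_not_ge hab)).symm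
  rw [max_eq_right hab]
  by_cases hb : b = 0
  · subst hb
    left
    rw [natDegree_zero, Nat.le_zero] at hab
    rw [natDegree_zero, ← hab, coeff_natDegree, leadingCoeff_ne_zero]
    rintro rfl
    exact not_isCoprime_zero_zero h
  · exact Or.inr (leadingCoeff_ne_zero.2 hb)

/-- The symmetric product of two pairs. -/
def symProd {R : Type*} [CommRing R] (a b c d : R) : Fin 3 → R := ![a * c, a * d + b * c, b * d]

/-- The entries are the coefficients of (aT + b)(cT + d), and modulo a maximal ideal a product of
nonzero polynomials is nonzero. -/
theorem span_symProd {R : Type*} [CommRing R] {a b c d : R} (h : IsCoprime a b)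
    (h' : IsCoprime c d) : Ideal.span (Set.range (symProd a b c d)) = ⊤ := by
  by_contra hne
  obtain ⟨M, hM, hle⟩ := Ideal.exists_le_maximal _ hne
  have hmem : ∀ i, symProd a b c d i ∈ M := fun i => hle (Ideal.subset_span ⟨i, rfl⟩)
  have h0 : a * c ∈ M := hmem 0
  have h1 : a * d + b * c ∈ M := hmem 1
  have h2 : b * d ∈ M := hmem 2
  have hcop : ∀ {s t : R}, IsCoprime s t → s ∈ M → t ∈ M → False := by
    rintro s t ⟨k, l, hkl⟩ hs ht
    exact hM.ne_top ((Ideal.eq_top_iff_one _).2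
      (hkl ▸ add_mem (M.mul_mem_left k hs) (M.mul_mem_left l ht)))
  have hp := hM.isPrime
  rcases hp.mem_or_mem h0 with ha | hc
  · have hbc : b * c ∈ M := by
      have := sub_mem h1 (M.mul_mem_right d ha)
      rwa [add_sub_cancel_left] at this
    have hb : b ∉ M := hcop h ha
    exact hcop h' ((hp.mem_or_mem hbc).resolve_left hb) ((hp.mem_or_mem h2).resolve_left hb)
  · have had : a * d ∈ M := by
      have := sub_mem h1 (M.mul_mem_left b hc)
      rwa [add_sub_cancel_right] at this
    have hd : d ∉ M := hcop h' hc
    exact hcop h ((hp.mem_or_mem had).resolve_right hd) ((hp.mem_or_mem h2).resolve_right hd)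

theorem topDegree_symProd {a b c d : F[X]} (h : IsCoprime a b) (h' : IsCoprime c d) :
    TopDegree (symProd a b c d)
      (max a.natDegree b.natDegree + max c.natDegree d.natDegree) := by
  have h0 := h.coeff_max_natDegree
  have h0' := h'.coeff_max_natDegree
  have ha := le_max_left a.natDegree b.natDegree
  have hb := le_max_right a.natDegree b.natDegree
  have hc := le_max_left c.natDegree d.natDegree
  have hd := le_max_right c.natDegree d.natDegree
  generalize max a.natDegree b.natDegree = m at *
  generalize max c.natDegree d.natDegree = n at *
  constructor
  · intro i
    fin_cases i
    · exact natDegree_mul_le_of_le ha hc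
    · exact natDegree_add_le_of_degree_le (natDegree_mul_le_of_le ha hd)
        (natDegree_mul_le_of_le hb hc)
    · exact natDegree_mul_le_of_le hb hd
  · by_contra! hcon
    have e0 : (a * c).coeff (m + n) = 0 := hcon 0
    have e1 : (a * d + b * c).coeff (m + n) = 0 := hcon 1
    have e2 : (b * d).coeff (m + n) = 0 := hcon 2
    rw [coeff_mul_add_eq_of_natDegree_le ha hc] at e0
    rw [coeff_add, coeff_mul_add_eq_of_natDegree_le ha hd,
      coeff_mul_add_eq_of_natDegree_le hb hc] at e1
    rw [coeff_mul_add_eq_of_natDegree_le hb hd] at e2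
    grind

end PrimitiveVectors

namespace WeierstrassCurve.Affine

noncomputable section

variable {F : Type*} [Field F] (W : Affine F)

/-- By `addSubMapCoeff_condition` the fourth power of each entry of `v` is a combination of the
values, so a maximal ideal containing the values would contain `v`. -/
theorem span_addSubMap [W.IsElliptic] {v : Fin 3 → F[X]} (hv : Ideal.span (Set.range v) = ⊤) :
    Ideal.span (Set.range fun i => (addSubMap (W.map C) i).eval v) = ⊤ := by
  by_contra hne
  obtain ⟨M, hM, hle⟩ := Ideal.exists_le_maximal _ hne
  refine hM.ne_top (top_le_iff.1 (hv ▸ Ideal.span_le.2 ?_))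
  rintro _ ⟨i, rfl⟩
  refine hM.isPrime.mem_of_pow_mem 4 ?_
  rw [← addSubMapCoeff_condition (W.map C)]
  exact sum_mem fun j _ => M.mul_mem_left _ (hle (Ideal.subset_span ⟨j, rfl⟩))

theorem eval_addSubMap_map_C (v : Fin 3 → F[X]) (i : Fin 3) :
    (addSubMap (W.map C) i).eval v =
      ![C 1 * v 0 * v 0 - C W.b₄ * v 0 * v 2 - C W.b₆ * v 1 * v 2 - C W.b₈ * v 2 * v 2,
        C 2 * v 1 * v 0 + C W.b₂ * v 0 * v 2 + C W.b₄ * v 1 * v 2 + C W.b₆ * v 2 * v 2,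
        C 1 * v 1 * v 1 - C 4 * v 0 * v 2] i := by
  rw [eval_addSubMap, map_b₂, map_b₄, map_b₆, map_b₈]
  fin_cases i <;> simp only [Fin.zero_eta, Fin.mk_one, Fin.reduceFinMk, Fin.isValue,
    Matrix.cons_val, map_one, map_ofNat, one_mul, pow_two, mul_assoc]

theorem natDegree_addSubMap_le {v : Fin 3 → F[X]} {n : ℕ} (hv : ∀ i, (v i).natDegree ≤ n)
    (i : Fin 3) : ((addSubMap (W.map C) i).eval v).natDegree ≤ n + n := by
  have h : ∀ (c : F) (i j : Fin 3), (C c * v i * v j).natDegree ≤ n + n := fun c i j =>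
    natDegree_mul_le_of_le ((natDegree_C_mul_le _ _).trans (hv i)) (hv j)
  rw [eval_addSubMap_map_C]
  fin_cases i
  · exact natDegree_sub_le_of_le (natDegree_sub_le_of_le (natDegree_sub_le_of_le (h _ _ _)
      (h _ _ _)) (h _ _ _)) (h _ _ _) |>.trans (by simp)
  · exact natDegree_add_le_of_degree_le (natDegree_add_le_of_degree_le
      (natDegree_add_le_of_degree_le (h _ _ _) (h _ _ _)) (h _ _ _)) (h _ _ _)
  · exact natDegree_sub_le_of_le (h _ _ _) (h _ _ _) |>.trans (by simp)

theorem coeff_addSubMap {v : Fin 3 → F[X]} {n : ℕ} (hv : ∀ i, (v i).natDegree ≤ n) (i : Fin 3) :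
    ((addSubMap (W.map C) i).eval v).coeff (n + n) =
      (addSubMap W i).eval fun j => (v j).coeff n := by
  have h : ∀ (c : F) (i j : Fin 3), (C c * v i * v j).coeff (n + n) =
      c * (v i).coeff n * (v j).coeff n := fun c i j => by
    rw [coeff_mul_add_eq_of_natDegree_le ((natDegree_C_mul_le _ _).trans (hv i)) (hv j),
      coeff_C_mul]
  rw [eval_addSubMap_map_C, eval_addSubMap]
  fin_cases i <;> simp only [Fin.zero_eta, Fin.mk_one, Fin.reduceFinMk, Fin.isValue,
    Matrix.cons_val, coeff_add, coeff_sub, h] <;> ring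

/-- The top coefficients are `addSubMap` of the top coefficients of `v`, hence not all zero: no
degree is lost at infinity. -/
theorem topDegree_addSubMap [W.IsElliptic] {v : Fin 3 → F[X]} {n : ℕ} (hv : TopDegree v n) :
    TopDegree (fun i => (addSubMap (W.map C) i).eval v) (n + n) := by
  refine ⟨natDegree_addSubMap_le W hv.1, ?_⟩
  by_contra! hcon
  refine addSubMap_ne_zero W (x := fun j => (v j).coeff n) ?_ (funext fun i => ?_)
  · obtain ⟨i, hi⟩ := hv.2
    exact fun h => hi (congrFun h i)
  · rw [← coeff_addSubMap W hv.1, hcon]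
    rfl

theorem addSubMap_map {R S : Type*} [CommRing R] [CommRing S] (W : Affine R) (f : R →+* S)
    (v : Fin 3 → R) (i : Fin 3) :
    (addSubMap (W.map f) i).eval (fun j => f (v j)) = f ((addSubMap W i).eval v) := by
  rw [eval_addSubMap, eval_addSubMap, map_b₂, map_b₄, map_b₆, map_b₈]
  have h2 : f 2 = 2 := map_ofNat f 2
  have h4 : f 4 = 4 := map_ofNat f 4
  fin_cases i <;> simp [h2, h4]

theorem addSubMap_smul {R : Type*} [CommRing R] (W : Affine R) (c : R) (v : Fin 3 → R)
    (i : Fin 3) : (addSubMap W i).eval (fun j => c * v j) = c ^ 2 * (addSubMap W i).eval v := by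
  rw [eval_addSubMap, eval_addSubMap]
  fin_cases i <;> simp only [Fin.zero_eta, Fin.mk_one, Fin.reduceFinMk, Fin.isValue,
    Matrix.cons_val] <;> ring

open WeierstrassCurve.Affine.FunctionField

variable {W}

/-- The `x`-coordinate of a point over the function field is a rational function of degree `n`
in `x`. -/
def HasHeight (P : (W⁄W.FunctionField).Point) (n : ℕ) : Prop :=
  ∃ a b : F[X], IsCoprime a b ∧ max a.natDegree b.natDegree = n ∧ ∃ c ≠ 0,
    P.xRep 0 = c * algebraMap F[X] W.FunctionField a ∧
    P.xRep 1 = c * algebraMap F[X] W.FunctionField b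

theorem hasHeight_zero : HasHeight (0 : (W⁄W.FunctionField).Point) 0 :=
  ⟨1, 0, isCoprime_one_left, by simp, 1, one_ne_zero, by simp, by simp⟩

theorem hasHeight_some_of_polynomial {a : F[X]} {b : W.FunctionField}
    (h : (W⁄W.FunctionField).Nonsingular (algebraMap F[X] W.FunctionField a) b) :
    HasHeight (.some _ _ h) a.natDegree :=
  ⟨a, 1, isCoprime_one_right, by simp, 1, one_ne_zero, by simp, by simp⟩

variable [W.IsElliptic] [DecidableEq W.FunctionField]

theorem hasHeight_generic : HasHeight (generic W) 1 := by
  have := hasHeight_some_of_polynomial (a := X) (equation_iff_nonsingular.1 (equation_generic W))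
  rwa [natDegree_X] at this

/-- The parallelogram law for the generic point. -/
theorem HasHeight.add_add_sub {P : (W⁄W.FunctionField).Point} {n n₁ n₂ : ℕ} (h : HasHeight P n)
    (h₁ : HasHeight (P + generic W) n₁) (h₂ : HasHeight (P - generic W) n₂) :
    n₁ + n₂ = 2 * n + 2 := by
  obtain ⟨a, b, hab, rfl, k, hk, ha, hb⟩ := h
  obtain ⟨a₁, b₁, hab₁, rfl, k₁, hk₁, ha₁, hb₁⟩ := h₁
  obtain ⟨a₂, b₂, hab₂, rfl, k₂, hk₂, ha₂, hb₂⟩ := h₂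
  let ι := algebraMap F[X] W.FunctionField
  have hι : Function.Injective ι := FaithfulSMul.algebraMap_injective _ _
  -- `v` encodes x(P ± g), and `w` is computed from `u`, which encodes x(P) and x(g). Both are
  -- primitive, they are proportional over K, and their exact degrees are n₁ + n₂ and 2(n + 1).
  let v := symProd a₁ b₁ a₂ b₂
  let u := symProd a b X 1
  let w : Fin 3 → F[X] := fun i => (addSubMap (W.map C) i).eval u
  have hv : Ideal.span (Set.range v) = ⊤ := span_symProd hab₁ hab₂
  have hw : Ideal.span (Set.range w) = ⊤ :=
    span_addSubMap W (span_symProd hab isCoprime_one_right)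
  have hv' : TopDegree v _ := topDegree_symProd hab₁ hab₂
  have hw' : TopDegree w _ := topDegree_addSubMap W (topDegree_symProd hab isCoprime_one_right)
  have hsym : P.sym2x (generic W) = fun i => k * ι (u i) := by
    funext i
    fin_cases i <;> simp [Point.sym2x, ha, hb, generic, u, symProd, x, ι] <;> ring
  have hsym' : (P + generic W).sym2x (P - generic W) = fun i => k₁ * k₂ * ι (v i) := by
    funext i
    fin_cases i <;> simp [Point.sym2x, ha₁, hb₁, ha₂, hb₂, v, symProd, ι] <;> ring
  obtain ⟨c, hc, hcw⟩ := Point.addSubMap_sym2x P (generic W)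
  have hcw' : ∀ i, k ^ 2 * ι (w i) = c * (k₁ * k₂) * ι (v i) := by
    intro i
    have := hcw i
    rw [hsym, hsym', addSubMap_smul] at this
    rw [mul_assoc c, ← this, ← addSubMap_map (W.map C) ι u i]
    congr 3
  obtain ⟨i, hi⟩ := hv'.2
  have hvi : v i ≠ 0 := fun h => hi (by rw [h, coeff_zero])
  have hmul : ∀ j, w i * v j = v i * w j := by
    intro j
    apply hι
    have h0 : c * (k₁ * k₂) ≠ 0 := mul_ne_zero hc (mul_ne_zero hk₁ hk₂)
    have h1 := hcw' i
    have h2 := hcw' j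
    rw [map_mul, map_mul]
    apply mul_left_cancel₀ (mul_ne_zero h0 (pow_ne_zero 2 hk))
    linear_combination (c * (k₁ * k₂) * ι (v j)) * h1 - (c * (k₁ * k₂) * ι (v i)) * h2
  have hN := hv'.unique hw' fun j => (natDegree_eq_of_mul_eq_mul hw hv hvi hmul j).symm
  rw [natDegree_X, natDegree_one] at hN
  omega

/-- The parallelogram law already determines n from n₁ and n₂. -/
theorem HasHeight.unique (P : (W⁄W.FunctionField).Point) {n n₁ n₂ m : ℕ} (h : HasHeight P n)
    (h' : HasHeight P m)
    (h₁ : HasHeight (P + generic W) n₁) (h₂ : HasHeight (P - generic W) n₂) : n = m := by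
  have := h.add_add_sub h₁ h₂
  have := h'.add_add_sub h₁ h₂
  omega

end

end WeierstrassCurve.Affine

end

/-! ### Odd points: their x-coordinates lie in F(x). -/

section

open Polynomial WeierstrassCurve WeierstrassCurve.Affine
open scoped IntermediateField RatFunc Polynomial.Bivariate

namespace WeierstrassCurve.Affine

noncomputable section

open WeierstrassCurve.Affine.FunctionField

variable {F : Type*} [Field F] [DecidableEq F] (W : Affine F) [W.IsElliptic]
  [DecidableEq W.FunctionField]

/-- The automorphism of the function field that negates the generic point. -/
def negAut : Gal(W.FunctionField/F) := (exists_neg W).choose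

theorem map_negAut_generic : Point.map (W' := W)
    (negAut W : W.FunctionField →ₐ[F] W.FunctionField) (generic W) = -generic W :=
  (exists_neg W).choose_spec

/-- The points negated by the automorphism that negates the generic point. -/
def oddPoints : AddSubgroup (W⁄W.FunctionField).Point where
  carrier := {P | Point.map (W' := W)
    (negAut W : W.FunctionField →ₐ[F] W.FunctionField) P = -P}
  zero_mem' := by rw [Set.mem_ofPred_eq, Point.map_zero, neg_zero]
  add_mem' hP hQ := by
    rw [Set.mem_ofPred_eq] at *
    rw [map_add, hP, hQ, neg_add]
  neg_mem' hP := by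
    rw [Set.mem_ofPred_eq] at *
    rw [map_neg, hP]

theorem generic_mem_oddPoints : generic W ∈ oddPoints W := map_negAut_generic W

theorem galEquiv_ext_generic {σ τ : Gal(W.FunctionField/F)}
    (h : Point.map (W' := W) (σ : W.FunctionField →ₐ[F] W.FunctionField) (generic W) =
      Point.map (W' := W) (τ : W.FunctionField →ₐ[F] W.FunctionField) (generic W)) : σ = τ :=
  AlgEquiv.ext fun z => DFunLike.congr_fun (algHom_ext_generic h) z

theorem map_mul_point (σ τ : Gal(W.FunctionField/F)) (P : (W⁄W.FunctionField).Point) :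
    Point.map (W' := W) ((σ * τ : Gal(W.FunctionField/F)) : W.FunctionField →ₐ[F] W.FunctionField) P
      = Point.map (W' := W) (σ : W.FunctionField →ₐ[F] W.FunctionField)
        (Point.map (W' := W) (τ : W.FunctionField →ₐ[F] W.FunctionField) P) := by
  rw [Point.map_map]
  rfl

theorem map_one_point (P : (W⁄W.FunctionField).Point) : Point.map (W' := W)
    ((1 : Gal(W.FunctionField/F)) : W.FunctionField →ₐ[F] W.FunctionField) P = P := by
  rcases P with _ | _ <;> rfl

variable {W}

/-- The fixed field of negation contains F(x), and K has degree 2 over each, so they coincide. -/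
theorem mem_range_ofRatFunc {z : W.FunctionField} (hσz : negAut W z = z) :
    ∃ r, ofRatFunc W r = z := by
  have hσ := map_negAut_generic W
  set σ := negAut W
  have hσ1 : σ ≠ 1 := by
    intro h1
    rw [h1, map_one_point] at hσ
    exact generic_ne_neg W hσ
  have hσ2 : σ ^ 2 = 1 := by
    apply galEquiv_ext_generic
    rw [pow_two, map_mul_point, hσ, map_neg, hσ, neg_neg, map_one_point]
  have hfix : ∀ w, σ w = w → ∀ τ ∈ Subgroup.zpowers σ, τ w = w := by
    intro w hw τ hτ
    have : Subgroup.zpowers σ ≤ MulAction.stabilizer Gal(W.FunctionField/F) w := by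
      rw [Subgroup.zpowers_le]
      exact hw
    exact this hτ
  have hord : orderOf σ = 2 := orderOf_eq_prime hσ2 hσ1
  have hX : ofRatFunc W RatFunc.X = x W := by
    rw [← RatFunc.algebraMap_X]
    exact (IsScalarTower.algebraMap_apply F[X] F⟮X⟯ W.FunctionField X).symm
  have hσx : σ (x W) = x W := by
    rw [generic, Point.map_some, Point.neg_some, Point.some.injEq] at hσ
    exact hσ.1
  have hcard : Nat.card (Subgroup.zpowers σ) = 2 := by rw [Nat.card_zpowers, hord]
  have hfin : Finite (Subgroup.zpowers σ) := Nat.finite_of_card_ne_zero (by omega)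
  have h1 : Module.finrank F⟮ofRatFunc W RatFunc.X⟯ W.FunctionField = 2 := by
    rw [finrank_adjoin_ofRatFunc]
    simp
  have h2 : Module.finrank (IntermediateField.fixedField (Subgroup.zpowers σ)) W.FunctionField
      = 2 := by
    have := Fintype.ofFinite (Subgroup.zpowers σ)
    rw [← hcard, Nat.card_eq_fintype_card]
    exact FixedPoints.finrank_eq_card (Subgroup.zpowers σ) W.FunctionField
  have hle : F⟮ofRatFunc W RatFunc.X⟯ ≤ IntermediateField.fixedField (Subgroup.zpowers σ) := by
    rw [IntermediateField.adjoin_simple_le_iff, IntermediateField.mem_fixedField_iff, hX]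
    exact hfix _ hσx
  have : FiniteDimensional F⟮ofRatFunc W RatFunc.X⟯ W.FunctionField :=
    FiniteDimensional.of_finrank_pos (by omega)
  have heq := IntermediateField.eq_of_le_of_finrank_eq' hle (h1.trans h2.symm)
  have hmem : z ∈ IntermediateField.fixedField (Subgroup.zpowers σ) := by
    rw [IntermediateField.mem_fixedField_iff]
    exact hfix _ hσz
  rw [← heq, ← Set.image_singleton, ← IntermediateField.adjoin_map] at hmem
  obtain ⟨r, -, hr⟩ := hmem
  exact ⟨r, hr⟩

theorem hasHeight_some_ofRatFunc {r : F⟮X⟯} {b : W.FunctionField}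
    (h : (W⁄W.FunctionField).Nonsingular (ofRatFunc W r) b) :
    HasHeight (.some _ _ h) (max r.num.natDegree r.denom.natDegree) := by
  have hmap : ∀ p : F[X], ofRatFunc W (algebraMap F[X] F⟮X⟯ p) = algebraMap F[X] W.FunctionField p :=
    fun p => (IsScalarTower.algebraMap_apply F[X] F⟮X⟯ W.FunctionField p).symm
  have hd : algebraMap F[X] W.FunctionField r.denom ≠ 0 := by
    rw [Ne, FaithfulSMul.algebraMap_eq_zero_iff]
    exact r.denom_ne_zero
  refine ⟨r.num, r.denom, r.isCoprime_num_denom, rfl,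
    (algebraMap F[X] W.FunctionField r.denom)⁻¹, inv_ne_zero hd, ?_, ?_⟩
  · conv_lhs => rw [Point.xRep_some, Matrix.cons_val_zero, ← r.num_div_denom, map_div₀, hmap, hmap]
    rw [div_eq_inv_mul]
  · rw [Point.xRep_some, inv_mul_cancel₀ hd]
    rfl

theorem exists_hasHeight {P : (W⁄W.FunctionField).Point} (hP : P ∈ oddPoints W) :
    ∃ n, HasHeight P n := by
  rcases P with _ | ⟨a, b, h⟩
  · exact ⟨0, hasHeight_zero⟩
  have h' : Point.map (W' := W) (negAut W : W.FunctionField →ₐ[F] W.FunctionField)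
      (.some a b h) = -.some a b h := hP
  rw [Point.map_some, Point.neg_some, Point.some.injEq] at h'
  obtain ⟨r, rfl⟩ := mem_range_ofRatFunc h'.1
  exact ⟨_, hasHeight_some_ofRatFunc h⟩

end

end WeierstrassCurve.Affine

end

/-! ### Quadratic growth of heights, divisibility by translations, Frobenius. -/

section

open Polynomial WeierstrassCurve WeierstrassCurve.Affine
open scoped IntermediateField RatFunc Polynomial.Bivariate

theorem Int.eq_quadratic_of_second_difference (f : ℤ → ℤ)
    (h : ∀ j, f (j + 1) + f (j - 1) = 2 * f j + 2) (j : ℤ) :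
    f j = f 0 + j * (f 1 - f 0 - 1) + j ^ 2 := by
  suffices H : f j = f 0 + j * (f 1 - f 0 - 1) + j ^ 2 ∧
      f (j + 1) = f 0 + (j + 1) * (f 1 - f 0 - 1) + (j + 1) ^ 2 from H.1
  induction j using Int.induction_on with
  | zero => constructor <;> (simp; try ring)
  | succ i ih =>
    refine ⟨ih.2, ?_⟩
    have := h (i + 1)
    rw [add_sub_cancel_right] at this
    linear_combination this + 2 * ih.2 - ih.1
  | pred i ih =>
    have := h (-i)
    rw [sub_add_cancel]
    refine ⟨?_, ih.1⟩
    linear_combination this + 2 * ih.1 - ih.2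

namespace WeierstrassCurve.Affine

noncomputable section

open WeierstrassCurve.Affine.FunctionField

variable {F : Type*} [Field F] [DecidableEq F] {W : Affine F} [W.IsElliptic]
  [DecidableEq W.FunctionField]

theorem hasHeight_constantPoint (P : (W⁄F).Point) : HasHeight (constantPoint W P) 0 := by
  rcases P with _ | ⟨a, b, h⟩
  · exact hasHeight_zero
  · have h' := hasHeight_some_of_polynomial (W := W) (a := C a) (b := algebraMap F _ b)
    rw [natDegree_C] at h'
    exact h' _

/-- Equality would make 2g constant, of height 0, whereas the parallelogram law makes the heights of
2g and 0 add up to 4. Thus no translation is a negation followed by a translation. -/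
theorem generic_add_constantPoint_ne (P Q : (W⁄F).Point) :
    generic W + constantPoint W P ≠ -generic W + constantPoint W Q := by
  intro h
  have h1 : HasHeight (generic W + generic W) 0 := by
    convert hasHeight_constantPoint (Q - P) using 1
    rw [map_sub]
    rw [eq_sub_iff_add_eq, add_assoc, h, add_neg_cancel_left]
  have h2 : HasHeight (generic W - generic W) 0 := by
    rw [sub_self]
    exact hasHeight_zero
  have := hasHeight_generic.add_add_sub h1 h2
  omega

theorem hasHeight_unique {P : (W⁄W.FunctionField).Point} (hP : P ∈ oddPoints W) {m n : ℕ}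
    (hm : HasHeight P m) (hn : HasHeight P n) : m = n := by
  obtain ⟨_, h₁⟩ := exists_hasHeight (add_mem hP (generic_mem_oddPoints W))
  obtain ⟨_, h₂⟩ := exists_hasHeight (sub_mem hP (generic_mem_oddPoints W))
  exact HasHeight.unique P hm hn h₁ h₂

theorem exists_hasHeight_add_zsmul {P : (W⁄W.FunctionField).Point} (hP : P ∈ oddPoints W) {n : ℕ}
    (hn : HasHeight P n) : ∃ B : ℤ, ∀ j : ℤ, ∃ m : ℕ,
      HasHeight (P + j • generic W) m ∧ (m : ℤ) = n + j * B + j ^ 2 := by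
  have hodd : ∀ j : ℤ, P + j • generic W ∈ oddPoints W := fun j =>
    add_mem hP (zsmul_mem (generic_mem_oddPoints W) j)
  choose f hf using fun j => exists_hasHeight (hodd j)
  have h0 : f 0 = n := hasHeight_unique (hodd 0) (hf 0) (by rwa [zero_zsmul, add_zero])
  refine ⟨f 1 - f 0 - 1, fun j => ⟨f j, hf j, ?_⟩⟩
  rw [← h0]
  refine Int.eq_quadratic_of_second_difference (fun j => (f j : ℤ)) (fun j => ?_) j
  have h1 := hf (j + 1)
  have h2 := hf (j - 1)
  rw [add_zsmul, one_zsmul, ← add_assoc] at h1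
  rw [sub_zsmul, one_zsmul, ← add_assoc, ← sub_eq_add_neg] at h2
  exact_mod_cast (hf j).add_add_sub h1 h2

/-- The automorphisms of the function field that are compositions of translations by points
of `G` and the negation. -/
def translationsAndNeg (G : AddSubgroup (W⁄F).Point) : Subgroup Gal(W.FunctionField/F) where
  carrier := {σ | ∃ Q ∈ G,
    Point.map (W' := W) (σ : W.FunctionField →ₐ[F] W.FunctionField) (generic W) =
      generic W + constantPoint W Q ∨
    Point.map (W' := W) (σ : W.FunctionField →ₐ[F] W.FunctionField) (generic W) =
      -generic W + constantPoint W Q}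
  one_mem' := ⟨0, zero_mem _, Or.inl (by rw [map_one_point, map_zero, add_zero])⟩
  mul_mem' := by
    rintro σ τ ⟨Q, hQ, hσ⟩ ⟨R, hR, hτ⟩
    simp only [Set.mem_ofPred_eq, map_mul_point]
    rcases hσ with hσ | hσ <;> rcases hτ with hτ | hτ <;>
      simp only [hτ, hσ, map_add, map_neg, map_constantPoint]
    · exact ⟨Q + R, add_mem hQ hR, Or.inl (by rw [map_add, add_assoc])⟩
    · exact ⟨-Q + R, add_mem (neg_mem hQ) hR, Or.inr (by rw [map_add, map_neg]; abel)⟩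
    · exact ⟨Q + R, add_mem hQ hR, Or.inr (by rw [map_add, add_assoc])⟩
    · exact ⟨-Q + R, add_mem (neg_mem hQ) hR, Or.inl (by rw [map_add, map_neg]; abel)⟩
  inv_mem' := by
    rintro σ ⟨Q, hQ, hσ⟩
    have h : Point.map (W' := W) ((σ⁻¹ : Gal(W.FunctionField/F)) :
        W.FunctionField →ₐ[F] W.FunctionField) (Point.map (W' := W)
        (σ : W.FunctionField →ₐ[F] W.FunctionField) (generic W)) = generic W := by
      rw [← map_mul_point, inv_mul_cancel, map_one_point]
    rcases hσ with hσ | hσ <;> rw [hσ] at h <;>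
      simp only [map_add, map_neg, map_constantPoint] at h
    · exact ⟨-Q, neg_mem hQ, Or.inl (by rw [map_neg, ← sub_eq_add_neg]; exact eq_sub_of_add_eq h)⟩
    · exact ⟨Q, hQ, Or.inr (by rw [neg_add_eq_iff_eq_add.1 h]; abel)⟩

theorem card_translationsAndNeg (G : AddSubgroup (W⁄F).Point) :
    Nat.card (translationsAndNeg G) = 2 * Nat.card G := by
  choose σ hσ using exists_translation W
  have hσ' : ∀ Q, Point.map (W' := W) ((negAut W * σ Q : Gal(W.FunctionField/F)) :
      W.FunctionField →ₐ[F] W.FunctionField) (generic W) = -generic W + constantPoint W Q := by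
    intro Q
    rw [map_mul_point, hσ, map_add, map_negAut_generic, map_constantPoint]
  let f : Bool × G → translationsAndNeg G := fun p =>
    if p.1 then ⟨σ p.2, p.2, p.2.2, Or.inl (hσ _)⟩
    else ⟨negAut W * σ p.2, p.2, p.2.2, Or.inr (hσ' _)⟩
  have hf : Function.Bijective f := by
    constructor
    · rintro ⟨b, Q⟩ ⟨c, R⟩ h
      have h' := congrArg (fun τ => Point.map (W' := W)
        (τ.1 : W.FunctionField →ₐ[F] W.FunctionField) (generic W)) h
      cases b <;> cases c <;> simp only [f, Bool.false_eq_true, if_true, if_false] at h' <;>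
        simp only [hσ, hσ'] at h'
      · rw [Subtype.ext (constantPoint_injective W (add_left_cancel h'))]
      · exact absurd h'.symm (generic_add_constantPoint_ne _ _)
      · exact absurd h' (generic_add_constantPoint_ne _ _)
      · rw [Subtype.ext (constantPoint_injective W (add_left_cancel h'))]
    · rintro ⟨τ, Q, hQ, hτ | hτ⟩
      · exact ⟨(true, ⟨Q, hQ⟩), Subtype.ext (galEquiv_ext_generic W ((hσ Q).trans hτ.symm))⟩
      · exact ⟨(false, ⟨Q, hQ⟩), Subtype.ext (galEquiv_ext_generic W ((hσ' Q).trans hτ.symm))⟩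
  rw [← Nat.card_congr (Equiv.ofBijective f hf), Nat.card_prod, Nat.card_eq_fintype_card,
    Fintype.card_bool]

theorem card_dvd_of_hasHeight (G : AddSubgroup (W⁄F).Point) [Finite G]
    {P : (W⁄W.FunctionField).Point} (hP : P ∈ oddPoints W)
    (hfix : ∀ Q ∈ G, ∀ σ : Gal(W.FunctionField/F),
      Point.map (W' := W) (σ : W.FunctionField →ₐ[F] W.FunctionField) (generic W) =
        generic W + constantPoint W Q →
      Point.map (W' := W) (σ : W.FunctionField →ₐ[F] W.FunctionField) P = P)
    {n : ℕ} (hn : HasHeight P n) : Nat.card G ∣ n := by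
  have hH : ∀ σ ∈ translationsAndNeg G,
      Point.map (W' := W) (σ : W.FunctionField →ₐ[F] W.FunctionField) P = P ∨
      Point.map (W' := W) (σ : W.FunctionField →ₐ[F] W.FunctionField) P = -P := by
    rintro σ ⟨Q, hQ, hσ | hσ⟩
    · exact Or.inl (hfix Q hQ σ hσ)
    -- Negation composed with σ sends g to g + Q, so it fixes P; hence σ sends P to -P, which has
    -- the same x-coordinate.
    · right
      have h := hfix Q hQ (negAut W * σ) (by
        rw [map_mul_point, hσ, map_add, map_neg, map_negAut_generic, neg_neg, map_constantPoint])
      rw [map_mul_point] at h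
      apply Point.map_injective (W' := W) (negAut W : W.FunctionField →ₐ[F] W.FunctionField)
      rw [h, map_neg]
      exact (neg_eq_iff_eq_neg.2 hP).symm
  rcases P with _ | ⟨a, b, h⟩
  · rw [hasHeight_unique hP hn hasHeight_zero]
    exact dvd_zero _
  · have h' : Point.map (W' := W) (negAut W : W.FunctionField →ₐ[F] W.FunctionField)
        (.some a b h) = -.some a b h := hP
    rw [Point.map_some, Point.neg_some, Point.some.injEq] at h'
    obtain ⟨r, rfl⟩ := mem_range_ofRatFunc h'.1
    have hcard := card_translationsAndNeg G
    have hpos : 0 < Nat.card G := Nat.card_pos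
    have : Finite (translationsAndNeg G) := Nat.finite_of_card_ne_zero (by omega)
    have hdvd := IntermediateField.card_dvd_finrank_adjoin_of_fixed (translationsAndNeg G)
      (z := ofRatFunc W r) fun σ hσ => by
        rcases hH σ hσ with h1 | h1
        · rw [Point.map_some, Point.some.injEq] at h1
          exact h1.1
        · rw [Point.map_some, Point.neg_some, Point.some.injEq] at h1
          exact h1.1
    rw [hcard, finrank_adjoin_ofRatFunc,
      hasHeight_unique hP (hasHeight_some_ofRatFunc h) hn] at hdvd
    exact Nat.dvd_of_mul_dvd_mul_left two_pos hdvd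

/-- The `n`-torsion of `E(F)` has order dividing `n ^ 2`. -/
theorem card_torsionBy_dvd [Finite F] [Finite (W⁄F).Point] (n : ℕ) :
    Nat.card (AddSubgroup.torsionBy (W⁄F).Point (n : ℤ)) ∣ n ^ 2 := by
  obtain ⟨B, hB⟩ := exists_hasHeight_add_zsmul (zero_mem (oddPoints W)) hasHeight_zero
  -- The height of j • g is jB + j², and its value at j = 1 is 1.
  have hB0 : B = 0 := by
    obtain ⟨m, hm, hmB⟩ := hB 1
    rw [zero_add, one_zsmul] at hm
    have := hasHeight_unique (generic_mem_oddPoints W) hm hasHeight_generic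
    subst this
    push_cast at hmB
    omega
  obtain ⟨m, hm, hmB⟩ := hB n
  have hmn : m = n ^ 2 := by
    rw [hB0] at hmB
    push_cast at hmB
    zify
    linear_combination hmB
  rw [← hmn]
  rw [zero_add] at hm
  refine card_dvd_of_hasHeight _ (zsmul_mem (generic_mem_oddPoints W) _) (fun Q hQ σ hσ => ?_) hm
  rw [map_zsmul, hσ, smul_add, natCast_zsmul, natCast_zsmul, ← map_nsmul,
    mem_torsionBy_natCast.1 hQ, map_zero, add_zero]

variable [Fintype F]

/-- The Frobenius image of the generic point. -/
def frobeniusPoint (W : Affine F) [W.IsElliptic] [DecidableEq W.FunctionField] :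
    (W⁄W.FunctionField).Point :=
  Point.map (W' := W) (FiniteField.frobeniusAlgHom F W.FunctionField) (generic W)

theorem map_frobeniusPoint (φ : W.FunctionField →ₐ[F] W.FunctionField) :
    Point.map (W' := W) φ (frobeniusPoint W) =
      Point.map (W' := W) (FiniteField.frobeniusAlgHom F W.FunctionField)
        (Point.map (W' := W) φ (generic W)) := by
  rw [frobeniusPoint, Point.map_map, Point.map_map]
  congr 2
  exact AlgHom.ext fun z => by simp

theorem frobeniusPoint_mem_oddPoints : frobeniusPoint W ∈ oddPoints W := by
  change Point.map _ _ = _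
  rw [map_frobeniusPoint, map_negAut_generic, map_neg, frobeniusPoint]

theorem hasHeight_frobeniusPoint : HasHeight (frobeniusPoint W) (Fintype.card F) := by
  have h : ∀ (a b : W.FunctionField) (hab : (W⁄W.FunctionField).Nonsingular a b),
      a = algebraMap F[X] W.FunctionField (X ^ Fintype.card F) →
      HasHeight (.some a b hab) (Fintype.card F) := by
    rintro a b hab rfl
    have := hasHeight_some_of_polynomial hab
    rwa [natDegree_X_pow] at this
  refine h _ _ _ ?_
  rw [map_pow]
  rfl

theorem dvd_card_sub_one [Finite (W⁄F).Point] {m : ℕ} (hm : 0 < m)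
    (h : Nat.card (AddSubgroup.torsionBy (W⁄F).Point (m : ℤ)) = m ^ 2) :
    m ∣ Fintype.card F - 1 := by
  obtain ⟨B, hB⟩ := exists_hasHeight_add_zsmul (frobeniusPoint_mem_oddPoints (W := W))
    hasHeight_frobeniusPoint
  -- Frobenius fixes constant points, so translation by an m-torsion point Q changes π + j • g by (1
  -- + j)Q = 0.
  have key : ∀ j : ℤ, (m : ℤ) ∣ 1 + j → (m : ℤ) ^ 2 ∣ Fintype.card F + j * B + j ^ 2 := by
    rintro j ⟨k, hk⟩
    obtain ⟨n, hn, hnB⟩ := hB j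
    rw [← hnB, ← Nat.cast_pow, Int.natCast_dvd_natCast, ← h]
    refine card_dvd_of_hasHeight _ (add_mem frobeniusPoint_mem_oddPoints
      (zsmul_mem (generic_mem_oddPoints W) _)) (fun Q hQ σ hσ => ?_) hn
    rw [map_add, map_frobeniusPoint, map_zsmul, hσ, map_add, map_constantPoint, ← frobeniusPoint,
      smul_add, add_add_add_comm]
    have h0 : constantPoint W Q + j • constantPoint W Q = 0 := by
      rw [← map_zsmul, ← map_add, ← one_add_zsmul, hk, mul_comm, mul_zsmul, natCast_zsmul,
        mem_torsionBy_natCast.1 hQ, zsmul_zero, map_zero]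
    rw [h0, add_zero]
  -- The values at m - 1 and -1 differ by m(B + m - 2), so m ∣ B - 2; then q - 1 = (q - B + 1) + (B
  -- - 2).
  have h1 := key (-1) (by simp)
  have h2 := key (m - 1) (by simp)
  have hm0 : (m : ℤ) ≠ 0 := by exact_mod_cast hm.ne'
  have h3 : (m : ℤ) ∣ B - 2 := by
    obtain ⟨k, hk⟩ := h1
    obtain ⟨l, hl⟩ := h2
    refine ⟨l - k - 1, mul_left_cancel₀ hm0 ?_⟩
    linear_combination hl - hk
  have h4 : (m : ℤ) ∣ Fintype.card F - 1 := by
    have h5 := (dvd_pow_self (m : ℤ) two_ne_zero).trans h1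
    rw [show (Fintype.card F : ℤ) - 1 = Fintype.card F + -1 * B + (-1) ^ 2 + (B - 2) by ring]
    exact dvd_add h5 h3
  have := Fintype.card_pos (α := F)
  rw [← Int.natCast_dvd_natCast, Nat.cast_sub (by omega)]
  exact_mod_cast h4

end

end WeierstrassCurve.Affine

end

/-! ### From the group structure to the decomposition of V. -/

namespace EllipticCount

open WeierstrassCurve

instance {F : Type*} [Field F] [Finite F] (W : WeierstrassCurve F) : Finite W.toAffine.Point := by
  have := Fintype.ofFinite F
  refine Finite.of_injective (fun P : W.toAffine.Point => match P with
    | .zero => (none : Option (F × F))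
    | .some x y _ => some (x, y)) ?_
  rintro (_ | ⟨x, y, h⟩) (_ | ⟨x', y', h'⟩) hP
  · rfl
  · cases hP
  · cases hP
  · simp only [Option.some.injEq, Prod.mk.injEq] at hP
    obtain ⟨rfl, rfl⟩ := hP
    rfl

/-- Isomorphic curves have isomorphic groups of points. -/
theorem nonempty_addEquiv_of_isoClass_eq {F : Type*} [Field F] [DecidableEq F] {E E' : EllCurve F}
    (h : isoClass E = isoClass E') :
    Nonempty (E.1.toAffine.Point ≃+ E'.1.toAffine.Point) := by
  obtain ⟨C, hC⟩ := Quotient.exact h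
  have := E.2
  have key : ∀ W : WeierstrassCurve F, C • E.1 = W →
      Nonempty (E.1.toAffine.Point ≃+ W.toAffine.Point) := by
    rintro _ rfl
    exact ⟨(AddEquiv.ofBijective _ (pointVariableChangeHom_bijective C E.1)).symm⟩
  exact key _ hC

theorem dvd_card_of_equiv {A : Type*} [AddCommGroup A] {N d : ℕ} (hN : 0 < N)
    (e : AddSubgroup.torsionBy A ((N / d.gcd (tFun N) : ℕ) : ℤ) ≃+
      ZMod d × ZMod (N / d.gcd (tFun N))) : N ∣ Nat.card A := by
  refine (dvd_mul_div_gcd_tFun hN d).trans ?_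
  have := Nat.card_congr e.toEquiv
  rw [Nat.card_prod, Nat.card_zmod, Nat.card_zmod] at this
  rw [← this]
  exact AddSubgroup.card_addSubgroup_dvd_card _

/-- The level n varies with d, but u(N) divides every such n; torsion at the common level u(N)
therefore allows different d to be compared. -/
theorem card_torsionBy_uFun {A : Type*} [AddCommGroup A] {N d : ℕ} (hN : 0 < N) (hd : d ∣ uFun N)
    (e : AddSubgroup.torsionBy A ((N / d.gcd (tFun N) : ℕ) : ℤ) ≃+
      ZMod d × ZMod (N / d.gcd (tFun N))) :
    Nat.card (AddSubgroup.torsionBy A (uFun N : ℤ)) = d * uFun N := by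
  have hd0 : NeZero d := ⟨fun h => (uFun_pos N).ne' (by rw [h] at hd; exact zero_dvd_iff.1 hd)⟩
  have hn0 : NeZero (N / d.gcd (tFun N)) := ⟨(Nat.div_pos (Nat.le_of_dvd hN (gcd_tFun_dvd hN d))
    (Nat.gcd_pos_of_pos_right _ (tFun_pos N))).ne'⟩
  rw [← card_torsionBy_torsionBy (uFun_dvd_div hN d), card_torsionBy_of_equiv_zmod_prod e,
    Nat.gcd_eq_left hd, Nat.gcd_eq_right (uFun_dvd_div hN d)]

/-- The group of rational points of an elliptic curve over a finite field is a product of two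
cyclic groups, the order of the first of which divides `q - 1`. -/
theorem exists_point_addEquiv {F : Type*} [Field F] [Fintype F] [DecidableEq F]
    (W : WeierstrassCurve F) [W.IsElliptic] : ∃ a b : ℕ, 0 < a ∧ 0 < b ∧ a ∣ b ∧
      a ∣ Fintype.card F - 1 ∧ Nonempty (W.toAffine.Point ≃+ ZMod a × ZMod b) := by
  classical
  have hW : W.baseChange F = W := W.map_id
  -- The base change of W to F equals W only propositionally; a variable `W'` carries the results
  -- across this equality of curves.
  have key : ∀ W' : WeierstrassCurve F, W.baseChange F = W' → (∀ n : ℕ,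
      Nat.card (AddSubgroup.torsionBy W'.toAffine.Point (n : ℤ)) ∣ n ^ 2) ∧ ∀ m : ℕ, 0 < m →
      Nat.card (AddSubgroup.torsionBy W'.toAffine.Point (m : ℤ)) = m ^ 2 →
      m ∣ Fintype.card F - 1 := by
    rintro _ rfl
    exact ⟨fun n => Affine.card_torsionBy_dvd (W := W.toAffine) n,
      fun m hm h => Affine.dvd_card_sub_one (W := W.toAffine) hm h⟩
  obtain ⟨h1, h2⟩ := key W hW
  obtain ⟨a, b, ha, hb, hab, ⟨e⟩⟩ := exists_addEquiv_zmod_prod (A := W.toAffine.Point)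
    fun p _ => h1 p
  refine ⟨a, b, ha, hb, hab, h2 a ha ?_, ⟨e⟩⟩
  have : NeZero a := ⟨ha.ne'⟩
  have : NeZero b := ⟨hb.ne'⟩
  rw [card_torsionBy_of_equiv_zmod_prod e, Nat.gcd_self, Nat.gcd_eq_right hab, pow_two]

theorem setV_eq {F : Type*} [Field F] [Fintype F] [DecidableEq F] {N : ℕ} (hN : 0 < N) :
    setV F N = ⋃ d ∈ (Nat.gcd (uFun N) (Fintype.card F - 1)).divisors,
      setW F d (N / Nat.gcd d (tFun N)) := by
  ext c
  simp only [Set.mem_iUnion, exists_prop]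
  constructor
  · rintro ⟨E, hE, hNE⟩
    have := E.2
    obtain ⟨a, b, ha, hb, hab, haq, ⟨e⟩⟩ := exists_point_addEquiv E.1
    have : NeZero a := ⟨ha.ne'⟩
    have : NeZero b := ⟨hb.ne'⟩
    rw [Nat.card_congr e.toEquiv, Nat.card_prod, Nat.card_zmod, Nat.card_zmod] at hNE
    obtain ⟨h1, h2⟩ := gcd_div_gcd_tFun ha hb hab hN hNE
    refine ⟨a.gcd (uFun N), ?_, E, hE, ?_⟩
    · rw [Nat.mem_divisors]
      exact ⟨Nat.dvd_gcd (Nat.gcd_dvd_right _ _) ((Nat.gcd_dvd_left _ _).trans haq),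
        (Nat.gcd_pos_of_pos_left _ (uFun_pos N)).ne'⟩
    · have e' := torsionByEquivOfZModProd e (N / (a.gcd (uFun N)).gcd (tFun N))
      rw [h1, Nat.gcd_eq_right h2] at e'
      exact ⟨e'⟩
  · rintro ⟨d, -, E, hE, ⟨e⟩⟩
    exact ⟨E, hE, dvd_card_of_equiv hN e⟩

theorem pairwiseDisjoint_setW {F : Type*} [Field F] [DecidableEq F] {N : ℕ} (hN : 0 < N) (k : ℕ) :
    ((Nat.gcd (uFun N) k).divisors : Set ℕ).PairwiseDisjoint
      (fun d => setW F d (N / Nat.gcd d (tFun N))) := by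
  intro d hd d' hd' hne
  refine Set.disjoint_left.2 ?_
  rintro c ⟨E, hE, ⟨e⟩⟩ ⟨E', hE', ⟨e'⟩⟩
  have hdvd : ∀ d ∈ (Nat.gcd (uFun N) k).divisors, d ∣ uFun N := fun d hd =>
    (Nat.dvd_of_mem_divisors hd).trans (Nat.gcd_dvd_left _ _)
  obtain ⟨f⟩ := nonempty_addEquiv_of_isoClass_eq (hE.trans hE'.symm)
  have h1 := card_torsionBy_uFun hN (hdvd d hd) e
  have h2 := card_torsionBy_uFun hN (hdvd d' hd') e'
  rw [Nat.card_congr (f.torsionByCongr (uFun N)).toEquiv, h2] at h1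
  exact hne (Nat.eq_of_mul_eq_mul_right (uFun_pos N) h1.symm)

theorem weightedCard_biUnion {F : Type*} [Field F] [Finite F] {ι : Type*} (s : Finset ι)
    (f : ι → Set (IsoClass F)) (h : (s : Set ι).PairwiseDisjoint f) :
    weightedCard (⋃ d ∈ s, f d) = ∑ d ∈ s, weightedCard (f d) := by
  have := finsum_mem_biUnion (f := fun c : IsoClass F => (1 : ℚ) / c.autCard) h s.finite_toSet
    fun i _ => Set.toFinite _
  simp only [weightedCard]
  rw [← finsum_mem_coe_finset]
  exact this

end EllipticCount

theorem mainTheorem10 (q : ℕ) (F : Type*) [Field F] [Fintype F] [DecidableEq F]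
    (hq : Fintype.card F = q) (N : ℕ) (hN : 0 < N) :
    (EllipticCount.setV F N =
        ⋃ d ∈ (Nat.gcd (EllipticCount.uFun N) (q - 1)).divisors,
          EllipticCount.setW F d (N / Nat.gcd d (EllipticCount.tFun N))) ∧
      ((Nat.gcd (EllipticCount.uFun N) (q - 1)).divisors : Set ℕ).PairwiseDisjoint
        (fun d => EllipticCount.setW F d (N / Nat.gcd d (EllipticCount.tFun N))) ∧
      EllipticCount.vCard F N =
        ∑ d ∈ (Nat.gcd (EllipticCount.uFun N) (q - 1)).divisors,
          EllipticCount.wCard F d (N / Nat.gcd d (EllipticCount.tFun N)) := by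
  subst hq
  have h1 := EllipticCount.setV_eq (F := F) hN
  have h2 := EllipticCount.pairwiseDisjoint_setW (F := F) hN (Fintype.card F - 1)
  refine ⟨h1, h2, ?_⟩
  rw [EllipticCount.vCard, h1]
  exact EllipticCount.weightedCard_biUnion _ _ h2
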